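/- **Setting.** Let $R$ be a commutative ring in which $2$ is invertible, and let $V=R[X]/(X^2-1)$ with basis $1,X$, comultiplication $\Delta(1)=1\otimes X+X\otimes 1$, $\Delta(X)=X\otimes X+1\otimes 1$, the bar operation $\overline{1}=1$, $\overline{X}=-X$, and the idempotents $\mathbf r=\frac{1+X}{2}$ (red), $\mathbf g=\frac{1-X}{2}$ (green). Let $K$ be an oriented virtual link diagram (a signed oriented Gauss code, possibly with components without classical crossings), with $n_-$ negative classical crossings. *Cut loci.* Draw each classical crossing with both strands pointing up. Its source-sink orientation orients the two ends of the strand running from bottom left to top right towards the crossing and the two other ends away from it. A semi-arc carries a cut locus (a cross cut of the associated abstract link diagram, ALD) if the source-sink orientations at its two ends disagree. *Complex.* A state is a choice of $A$- or $B$-smoothing at each classical crossing (the $A$-smoothing of a positive and the $B$-smoothing of a negative crossing being the oriented ones); it has homological degree (number of $B$-smoothings) $-\,n_-$. For each state fix, arbitrarily, a marked point off the cut loci on each cycle that meets a crossing, and a total order of all cycles. The Khovanov–Lee complex is, in degree $i$, the direct sum of the modules $V^{\otimes\{\text{cycles of }s\}}$ over the states $s$ of degree $i$. Its differential is the sum over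 the $A$-smoothed crossings of the maps that change this smoothing to $B$: the multiplication $m$ of $V$ if two cycles merge, $\Delta$ if a cycle splits, and $0$ if one cycle is turned into one cycle, and the identity on the tensor factors of the other cycles. Elements are transported along cycles between the marked points and the crossing (for the other cycles, between the marked points in the two states), the bar operation being applied once for each cut locus passed; and the map is multiplied by the signs of the permutations that compare, before and after, the chosen order of the cycles with the local order, in which the cycle through the left (respectively top) arc of the smoothed crossing comes first, the one through the right (respectively bottom) arc second if it is different, and then the remaining cycles, in an order that is the same before and after. *Alternately coloured smoothings.* An alternately coloured smoothing of $K$ on its ALD with cross cuts is a state of $K$ with a red/green colouring of its cycles such that the colour changes exactly at the cross cuts and the two arcs at each smoothed crossing have different colours. Its generator is the object of the Karoubi envelope given by $V^{\otimes\{\text{cycles}\}}$ and the projection that multiplies the factor of each cycle by $\mathbf r$ or $\mathbf g$ according to its colour at the marked point (or its constant colour if it meets no crossing). **Theorem.** For every such $K$, every choice of marked points and orders, and every $R$, the differential above squares to zero, and in the Karoubi envelope (of the category of $R$-modules) the Khovanov–Lee complex of $K$ is homotopy equivalent to the complex with vanishing differentials whose object in degree $i$ is the direct sum of the generators of the alternately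 coloured smoothings of $K$ whose state has degree $i$. Each of these generators is isomorphic to $R$. -/

import Mathlib

open CategoryTheory

namespace VirtualKhovanovLee

/-! ### Virtual link diagrams -/

/-- An oriented virtual link diagram with set `ι` of classical crossings, given by its signed
oriented Gauss code.  Every classical crossing `c` is passed twice, once on the over-strand
`(c, true)` and once on the under-strand `(c, false)`; `next` sends each passage to the one that
follows it along the oriented link.  `circles` is the number of components that meet no classical
crossing.  Virtual crossings are not recorded by a Gauss code. -/
structure VirtualLinkDiagram (ι : Type) where
  /-- whether the crossing is positive -/
  positive : ι → Bool
  /-- the passage that follows a given passage along the oriented link -/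
  next : Equiv.Perm (ι × Bool)
  /-- the number of components without classical crossings -/
  circles : ℕ

/-- The ends of the semi-arcs: `(c, o, e)` is the end at the crossing `c` lying on the over-strand
(`o = true`) or the under-strand (`o = false`), which leaves the crossing (`e = true`) or enters it
(`e = false`) in the orientation of the link.

Draw a crossing with both strands pointing upwards.  The over-strand of a positive crossing and the
under-strand of a negative one run from bottom left to top right, so an end `(c, o, e)` is at the
bottom left or the top right if `o = positive c`, and at the bottom right or the top left
otherwise. -/
abbrev HalfEdge (ι : Type) : Type := ι × Bool × Bool

/-- The state (choice of smoothings): `false` is the `A`-smoothing, `true` the `B`-smoothing. -/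
abbrev State (ι : Type) : Type := ι → Bool

variable {ι : Type}

namespace VirtualLinkDiagram

variable (D : VirtualLinkDiagram ι)

/-- The other end of the semi-arc. -/
def glue : HalfEdge ι → HalfEdge ι
  | (c, o, true) => ((D.next (c, o)).1, (D.next (c, o)).2, false)
  | (c, o, false) => ((D.next.symm (c, o)).1, (D.next.symm (c, o)).2, true)

/-- The other end of the arc of the smoothed crossing.  The `A`-smoothing of a positive crossing and
the `B`-smoothing of a negative one are the oriented smoothings, which join an entering end to the
leaving end of the other strand; the remaining smoothings join the two entering ends and the two
leaving ends. -/
def smooth (s : State ι) : HalfEdge ι → HalfEdge ι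
  | (c, o, e) => if s c ≠ D.positive c then (c, !o, !e) else (c, !o, e)

/-- The canonical source-sink orientation of the four ends at a crossing: the ends of the strand
that runs from bottom left to top right point towards the crossing, the two other ends point away
from it. -/
def Inward : HalfEdge ι → Prop
  | (c, o, _) => o = D.positive c

/-- A semi-arc carries a cut locus if the source-sink orientations at its two ends disagree. -/
def IsCut (h : HalfEdge ι) : Prop := D.Inward h ↔ D.Inward (D.glue h)

/-- The top left end at a crossing.  It lies on the first arc of either smoothing (the left arc of
the oriented one, the top arc of the other one). -/
def site₁ (c : ι) : HalfEdge ι := (c, !D.positive c, true)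

/-- The bottom right end at a crossing.  It lies on the second arc of either smoothing (the right
arc of the oriented one, the bottom arc of the other one). -/
def site₂ (c : ι) : HalfEdge ι := (c, !D.positive c, false)

theorem glue_glue (h : HalfEdge ι) : D.glue (D.glue h) = h := by
  rcases h with ⟨c, o, _ | _⟩ <;> simp [glue]

theorem smooth_smooth (s : State ι) (h : HalfEdge ι) : D.smooth s (D.smooth s h) = h := by
  rcases h with ⟨c, o, e⟩
  by_cases hc : s c = D.positive c <;> simp [smooth, hc]

theorem isCut_glue (h : HalfEdge ι) : D.IsCut (D.glue h) ↔ D.IsCut h := by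
  simp only [IsCut, glue_glue]; exact Iff.comm

/-! ### Cycles of a state -/

open Classical in
/-- `D.CutPath s h k n`: in the state `s` there is a path along the cycles from `h` to `k` that
crosses `n` cut loci. -/
inductive CutPath (s : State ι) (h : HalfEdge ι) : HalfEdge ι → ℕ → Prop
  | refl : CutPath s h h 0
  | smooth {k : HalfEdge ι} {n : ℕ} : CutPath s h k n → CutPath s h (D.smooth s k) n
  | glue {k : HalfEdge ι} {n : ℕ} : CutPath s h k n →
      CutPath s h (D.glue k) (n + if D.IsCut k then 1 else 0)

variable {D} in
theorem CutPath.trans {s : State ι} {h k l : HalfEdge ι} {m n : ℕ} (p : D.CutPath s h k m)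
    (q : D.CutPath s k l n) : D.CutPath s h l (m + n) := by
  induction q with
  | refl => exact p
  | smooth _ ih => exact ih.smooth
  | glue _ ih => rw [← add_assoc]; exact ih.glue

open Classical in
variable {D} in
theorem CutPath.symm {s : State ι} {h k : HalfEdge ι} {n : ℕ} (p : D.CutPath s h k n) :
    D.CutPath s k h n := by
  induction p with
  | refl => exact .refl
  | @smooth k n _ ih =>
    have := (CutPath.refl (D := D) (s := s) (h := D.smooth s k)).smooth
    rw [D.smooth_smooth] at this
    simpa using this.trans ih
  | @glue k n _ ih =>
    have := (CutPath.refl (D := D) (s := s) (h := D.glue k)).glue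
    rw [D.glue_glue, zero_add] at this
    have e : (if D.IsCut (D.glue k) then 1 else 0) = if D.IsCut k then 1 else 0 :=
      if_congr (D.isCut_glue k) rfl rfl
    rw [e] at this
    rw [add_comm]
    exact this.trans ih

/-- Two ends are equivalent if they lie on the same cycle of the state `s`. -/
def cycleSetoid (s : State ι) : Setoid (HalfEdge ι) where
  r h k := ∃ n, D.CutPath s h k n
  iseqv := ⟨fun _ => ⟨0, .refl⟩, fun ⟨n, p⟩ => ⟨n, p.symm⟩,
    fun ⟨m, p⟩ ⟨n, q⟩ => ⟨m + n, p.trans q⟩⟩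

/-- The cycles of the state `s` that pass through some crossing. -/
abbrev CrossingCycle (s : State ι) : Type := Quotient (D.cycleSetoid s)

/-- All cycles of the state `s`. -/
abbrev Cycle (s : State ι) : Type := D.CrossingCycle s ⊕ Fin D.circles

/-- The cycle of the state `s` through `h`. -/
def cycleOf (s : State ι) (h : HalfEdge ι) : D.CrossingCycle s := Quotient.mk (D.cycleSetoid s) h

noncomputable instance (s : State ι) : DecidableEq (D.Cycle s) := Classical.decEq _

noncomputable instance [Finite ι] (s : State ι) : Fintype (D.Cycle s) :=
  haveI : Finite (D.CrossingCycle s) := Quotient.finite _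
  Fintype.ofFinite _

/-- The parity condition for the bar operation: transporting an algebra element from `h` to `k`
along a cycle crosses an odd number of cut loci. -/
def Barred (s : State ι) (h k : HalfEdge ι) : Prop := ∃ n, Odd n ∧ D.CutPath s h k n

/-- The (arbitrary) global choices for the states of a diagram: a marked point on each cycle, at
which the global orientation agrees with the local one, and an order of the cycles. -/
structure GlobalData [Finite ι] where
  /-- the marked point of a cycle -/
  star : ∀ s : State ι, D.CrossingCycle s → HalfEdge ι
  cycleOf_star : ∀ (s : State ι) (z : D.CrossingCycle s), D.cycleOf s (star s z) = z
  /-- the global order of the cycles -/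
  order : ∀ s : State ι, D.Cycle s ≃ Fin (Fintype.card (D.Cycle s))

end VirtualLinkDiagram

/-! ### The Frobenius algebra `R[X]/(X² - 1)` -/

/-- The basis `1, X` of the algebra. -/
inductive Label : Type
  | one
  | X
  deriving DecidableEq

instance : Fintype Label := ⟨{.one, .X}, fun a => by cases a <;> decide⟩

/-- The product of two basis elements: `X * X = 1`. -/
def Label.mul : Label → Label → Label
  | .one, b => b
  | .X, .one => .X
  | .X, .X => .one

section Algebra

variable (R : Type*) [CommRing R]

/-- The coefficient of `c` in the product `m (a ⊗ b)`. -/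
def mulCoeff (a b c : Label) : R := if a.mul b = c then 1 else 0

/-- The coefficient of `b ⊗ c` in `Δ a`: `Δ 1 = 1 ⊗ X + X ⊗ 1` and `Δ X = X ⊗ X + 1 ⊗ 1`. -/
def comulCoeff : Label → Label → Label → R
  | .one, .one, .X => 1
  | .one, .X, .one => 1
  | .X, .X, .X => 1
  | .X, .one, .one => 1
  | _, _, _ => 0

open Classical in
/-- The sign by which the bar operation (`1 ↦ 1`, `X ↦ -X`), applied if `P` holds, multiplies a
basis element. -/
noncomputable def barSign (P : Prop) (a : Label) : R := if P ∧ a = .X then -1 else 1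

end Algebra

/-- The two colours. -/
inductive Colour : Type
  | red
  | green
  deriving DecidableEq

instance : Fintype Colour := ⟨{.red, .green}, fun a => by cases a <;> decide⟩

/-- The coefficients of the idempotents `red = (1 + X) / 2` and `green = (1 - X) / 2`. -/
def Colour.coeff (R : Type*) [CommRing R] [Invertible (2 : R)] : Colour → Label → R
  | .red, _ => ⅟2
  | .green, .one => ⅟2
  | .green, .X => -⅟2

/-- The coefficient of `b` in the product of the idempotent `k` with the basis element `a`. -/
def Colour.projCoeff (R : Type*) [CommRing R] [Invertible (2 : R)] (k : Colour) (b a : Label) : R :=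
  ∑ l, k.coeff R l * mulCoeff R l a b

/-! ### The differential -/

namespace VirtualLinkDiagram

variable (D : VirtualLinkDiagram ι)

/-- The cycle `z` of the state `s` does not meet the crossing `c`, and `z'` is the same cycle in the
state `s'`. -/
def Unaffected (c : ι) (s s' : State ι) : D.Cycle s × D.Cycle s' → Prop
  | (.inl z, .inl z') => z ≠ D.cycleOf s (D.site₁ c) ∧ z ≠ D.cycleOf s (D.site₂ c) ∧
      ∃ h, D.cycleOf s h = z ∧ D.cycleOf s' h = z'
  | (.inr i, .inr j) => i = j
  | _ => False

/-- An enhanced state: a state whose cycles are labelled by `1` or `X`.  These form a basis of the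
direct sum over the states `s` of the tensor powers `V^{⊗ cycles of s}`. -/
abbrev EnhancedState : Type := (s : State ι) × (D.Cycle s → Label)

variable {D} [Finite ι] (G : D.GlobalData)

namespace GlobalData

/-- The sign of the permutation that moves the cycle `z` to the first place. -/
noncomputable def sign₁ (s : State ι) (z : D.CrossingCycle s) : ℤ := (-1) ^ (G.order s (.inl z) : ℕ)

/-- The sign of the permutation that moves `z` to the first and `w` to the second place. -/
noncomputable def sign₂ (s : State ι) (z w : D.CrossingCycle s) : ℤ :=
  if G.order s (.inl z) < G.order s (.inl w) then
    (-1) ^ ((G.order s (.inl z) : ℕ) + (G.order s (.inl w) : ℕ) + 1)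
  else (-1) ^ ((G.order s (.inl z) : ℕ) + (G.order s (.inl w) : ℕ))

open Classical in
/-- The sign of the permutation that compares the global orders of `s` and `s'` on the cycles that
do not meet the crossing `c`. -/
noncomputable def restSign (c : ι) (s s' : State ι) : ℤ :=
  (-1) ^ (Finset.univ.filter fun p : (D.Cycle s × D.Cycle s') × (D.Cycle s × D.Cycle s') =>
    D.Unaffected c s s' p.1 ∧ D.Unaffected c s s' p.2 ∧
      G.order s p.1.1 < G.order s p.2.1 ∧ G.order s' p.2.2 < G.order s' p.1.2).card

/-- Whether transport between the marked points of the same cycle in two states crosses an odd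
number of cut loci. -/
def StarBarred (s s' : State ι) : D.Cycle s × D.Cycle s' → Prop
  | (.inl z, .inl z') => D.Barred s (G.star s z) (G.star s' z')
  | _ => False

variable (R : Type*) [CommRing R]

open Classical in
/-- The identity on the tensor factors of the cycles that do not meet `c`: their labels stay the
same, up to transport between the marked points. -/
noncomputable def restCoeff (c : ι) (s s' : State ι) (l : D.Cycle s → Label)
    (l' : D.Cycle s' → Label) : R :=
  ∏ p : D.Cycle s × D.Cycle s', if D.Unaffected c s s' p then
    (if l p.1 = l' p.2 then barSign R (G.StarBarred s s' p) (l p.1) else 0) else 1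

/-- The effect of the bar operation on the label of the cycle through `h` when it is transported
between `h` and the marked point of the cycle. -/
noncomputable def siteSign (s : State ι) (l : D.Cycle s → Label) (h : HalfEdge ι) : R :=
  barSign R (D.Barred s h (G.star s (D.cycleOf s h))) (l (.inl (D.cycleOf s h)))

open Classical in
/-- The local map at the crossing `c` from the state `s` (with `A`-smoothing at `c`) to the state
`s'` (with `B`-smoothing at `c`): multiplication if two cycles merge, comultiplication if a cycle
splits, each pre- and post-composed with the bar operations and the signs of the permutations
between local and global orders, and the zero map `η` if one cycle is turned into one cycle. -/
noncomputable def localCoeff (c : ι) (s s' : State ι) (l : D.Cycle s → Label)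
    (l' : D.Cycle s' → Label) : R :=
  if D.cycleOf s (D.site₁ c) ≠ D.cycleOf s (D.site₂ c) ∧
      D.cycleOf s' (D.site₁ c) = D.cycleOf s' (D.site₂ c) then
    ((G.sign₂ s (D.cycleOf s (D.site₁ c)) (D.cycleOf s (D.site₂ c)) *
        G.sign₁ s' (D.cycleOf s' (D.site₁ c)) : ℤ) : R) *
      (G.siteSign R s l (D.site₁ c) * G.siteSign R s l (D.site₂ c) *
        mulCoeff R (l (.inl (D.cycleOf s (D.site₁ c)))) (l (.inl (D.cycleOf s (D.site₂ c))))
          (l' (.inl (D.cycleOf s' (D.site₁ c)))) *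
        G.siteSign R s' l' (D.site₁ c))
  else if D.cycleOf s (D.site₁ c) = D.cycleOf s (D.site₂ c) ∧
      D.cycleOf s' (D.site₁ c) ≠ D.cycleOf s' (D.site₂ c) then
    ((G.sign₁ s (D.cycleOf s (D.site₁ c)) *
        G.sign₂ s' (D.cycleOf s' (D.site₁ c)) (D.cycleOf s' (D.site₂ c)) : ℤ) : R) *
      (G.siteSign R s l (D.site₁ c) *
        comulCoeff R (l (.inl (D.cycleOf s (D.site₁ c))))
          (l' (.inl (D.cycleOf s' (D.site₁ c)))) (l' (.inl (D.cycleOf s' (D.site₂ c)))) *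
        (G.siteSign R s' l' (D.site₁ c) * G.siteSign R s' l' (D.site₂ c)))
  else 0

end GlobalData

end VirtualLinkDiagram

namespace VirtualLinkDiagram.GlobalData

variable [Fintype ι] [DecidableEq ι] {D : VirtualLinkDiagram ι} (G : D.GlobalData)

section Differential

variable (R : Type*) [CommRing R]

/-- The matrix of the differential: the entry at `(y, x)` is the coefficient of the enhanced state
`y` in `∂ x`, the sum over the sites `c` with an `A`-smoothing in `x` of the partial differentials
that resmooth `c`. -/
noncomputable def differential : Matrix D.EnhancedState D.EnhancedState R := fun y x =>
  ∑ c, if x.1 c = false ∧ y.1 = Function.update x.1 c true then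
    (G.restSign c x.1 y.1 : R) * G.restCoeff R c x.1 y.1 x.2 y.2 *
      G.localCoeff R c x.1 y.1 x.2 y.2 else 0

end Differential

end VirtualLinkDiagram.GlobalData

namespace VirtualLinkDiagram

variable [Fintype ι]

/-- The homological degree of a state: the number of `B`-smoothings minus the number of negative
crossings. -/
def height (D : VirtualLinkDiagram ι) (s : State ι) : ℤ :=
  ((Finset.univ.filter fun c => s c = true).card : ℤ) -
    ((Finset.univ.filter fun c => D.positive c = false).card : ℤ)

theorem height_update [DecidableEq ι] (D : VirtualLinkDiagram ι) (s : State ι) (c : ι)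
    (hc : s c = false) : D.height (Function.update s c true) = D.height s + 1 := by
  have h : (Finset.univ.filter fun i => Function.update s c true i = true) =
      insert c (Finset.univ.filter fun i => s i = true) := by
    ext i
    by_cases hi : i = c
    · subst hi; simp
    · simp [hi]
  rw [height, height, h, Finset.card_insert_of_notMem (by simp [hc])]
  push_cast
  ring

end VirtualLinkDiagram

namespace VirtualLinkDiagram.GlobalData

universe u

variable [Fintype ι] [DecidableEq ι] {D : VirtualLinkDiagram ι} (G : D.GlobalData)
  (R : Type u) [CommRing R]

theorem differential_eq_zero (x y : D.EnhancedState) (h : D.height x.1 + 1 ≠ D.height y.1) :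
    G.differential R y x = 0 := by
  unfold differential
  refine Finset.sum_eq_zero fun c _ => if_neg ?_
  rintro ⟨hc, hy⟩
  exact h (by rw [hy, D.height_update _ _ hc])

/-! ### The Khovanov-Lee complex -/

/-- The Khovanov-Lee complex: in degree `i` the free module on the enhanced states of height `i`. -/
noncomputable def complex (hd : G.differential R * G.differential R = 0) :
    CochainComplex (ModuleCat.{u} R) ℤ where
  X i := ModuleCat.of R ({x : D.EnhancedState // D.height x.1 = i} → R)
  d i j := ModuleCat.ofHom (Matrix.toLin' ((G.differential R).submatrix
    (Subtype.val : {x : D.EnhancedState // D.height x.1 = j} → _)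
    (Subtype.val : {x : D.EnhancedState // D.height x.1 = i} → _)))
  shape i j hij := by
    have : (G.differential R).submatrix
        (Subtype.val : {x : D.EnhancedState // D.height x.1 = j} → _)
        (Subtype.val : {x : D.EnhancedState // D.height x.1 = i} → _) = 0 := by
      ext y x
      exact G.differential_eq_zero R _ _ (by rw [x.2, y.2]; exact hij)
    rw [this, map_zero, ModuleCat.ofHom_zero]
  d_comp_d' i j k hij hjk := by
    rw [← ModuleCat.ofHom_comp, ← Matrix.toLin'_mul]
    have : (G.differential R).submatrix
        (Subtype.val : {x : D.EnhancedState // D.height x.1 = k} → _)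
        (Subtype.val : {x : D.EnhancedState // D.height x.1 = j} → _) *
        (G.differential R).submatrix
        (Subtype.val : {x : D.EnhancedState // D.height x.1 = j} → _)
        (Subtype.val : {x : D.EnhancedState // D.height x.1 = i} → _) = 0 := by
      ext z x
      have h := congrFun (congrFun hd z.1) x.1
      rw [Matrix.mul_apply] at h ⊢
      simp only [Matrix.submatrix_apply, Matrix.zero_apply] at h ⊢
      rw [← h]
      rw [← Finset.sum_subtype (Finset.univ.filter fun y : D.EnhancedState => D.height y.1 = j)
        (by simp) fun y => G.differential R z.1 y * G.differential R y x.1]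
      refine Finset.sum_subset (Finset.subset_univ _) fun y _ hy => ?_
      rw [G.differential_eq_zero R x.1 y, mul_zero]
      rw [x.2]
      intro e
      apply hy
      simp only [Finset.mem_filter, Finset.mem_univ, true_and]
      rw [← e]; exact hij
    rw [this, map_zero, ModuleCat.ofHom_zero]

end VirtualLinkDiagram.GlobalData

/-! ### Alternately coloured smoothings -/

/-- An alternately coloured smoothing on the abstract link diagram with cross cuts: a state together
with a red/green colouring of its strands that is constant along the strands of the smoothing,
changes exactly where a strand passes a cross cut (that is, a cut locus), and gives different colours
to the two arcs at each smoothed crossing. -/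
@[ext]
structure AlternatelyColouredSmoothing (D : VirtualLinkDiagram ι) where
  /-- the underlying state -/
  state : State ι
  /-- the colours of the strands at crossings -/
  colour : HalfEdge ι → Colour
  /-- the colours of the components without crossings -/
  circleColour : Fin D.circles → Colour
  colour_smooth : ∀ h, colour (D.smooth state h) = colour h
  colour_glue : ∀ h, colour (D.glue h) = colour h ↔ ¬ D.IsCut h
  alternate : ∀ c, colour (D.site₁ c) ≠ colour (D.site₂ c)

instance [Finite ι] (D : VirtualLinkDiagram ι) : Finite (AlternatelyColouredSmoothing D) :=
  Finite.of_injective (fun a => (a.state, a.colour, a.circleColour)) fun a b h => by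
    simp only [Prod.mk.injEq] at h
    exact AlternatelyColouredSmoothing.ext h.1 h.2.1 h.2.2

section Generators

universe u

variable (R : Type u) [CommRing R] [Invertible (2 : R)]

theorem Colour.sum_projCoeff (k : Colour) (c a : Label) :
    ∑ b, k.projCoeff R c b * k.projCoeff R b a = k.projCoeff R c a := by
  have h2 : (⅟2 : R) + ⅟2 = 1 := by rw [← two_mul, mul_invOf_self]
  have h4 : (⅟2 : R) * ⅟2 + ⅟2 * ⅟2 = ⅟2 := by rw [← mul_add, h2, mul_one]
  have hu : (Finset.univ : Finset Label) = {Label.one, Label.X} := by decide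
  cases k <;> cases c <;> cases a <;>
    simp [Colour.projCoeff, Colour.coeff, mulCoeff, Label.mul, hu, h4] <;>
    linear_combination -h4

/-- The projection of `V^{⊗ Z}` onto the summand with colours `k`: multiplication by the tensor
product of the idempotents `red` and `green` given by `k`, in the basis of labellings. -/
def colourProjection {Z : Type} [Fintype Z] (k : Z → Colour) : Matrix (Z → Label) (Z → Label) R :=
  fun b a => ∏ z, (k z).projCoeff R (b z) (a z)

theorem colourProjection_mul_self {Z : Type} [Fintype Z] [DecidableEq Z] (k : Z → Colour) :
    colourProjection R k * colourProjection R k = colourProjection R k := by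
  ext c a
  simp only [Matrix.mul_apply, colourProjection, ← Finset.prod_mul_distrib]
  rw [← Fintype.piFinset_univ, ← Finset.prod_univ_sum (fun _ => Finset.univ)
    (fun z b => (k z).projCoeff R (c z) b * (k z).projCoeff R b (a z))]
  exact Finset.prod_congr rfl fun z _ => Colour.sum_projCoeff R _ _ _

variable [Fintype ι] {D : VirtualLinkDiagram ι} (G : D.GlobalData)

/-- The colours of the cycles of an alternately coloured smoothing, read at the marked points. -/
def AlternatelyColouredSmoothing.cycleColour (a : AlternatelyColouredSmoothing D) :
    D.Cycle a.state → Colour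
  | .inl z => a.colour (G.star a.state z)
  | .inr i => a.circleColour i

/-- The generator of an alternately coloured smoothing: the object of the Karoubi envelope given by
the tensor power of its underlying state and the projection of its colouring. -/
noncomputable def AlternatelyColouredSmoothing.generator (a : AlternatelyColouredSmoothing D) :
    Idempotents.Karoubi (ModuleCat.{u} R) where
  X := ModuleCat.of R ((D.Cycle a.state → Label) → R)
  p := ModuleCat.ofHom (Matrix.toLin' (colourProjection R (a.cycleColour G)))
  idem := by rw [← ModuleCat.ofHom_comp, ← Matrix.toLin'_mul, colourProjection_mul_self]

/-- The complex with one generator for each alternately coloured smoothing, placed in the degree of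
its state, and with vanishing differentials. -/
noncomputable def generatorComplex :
    CochainComplex (Idempotents.Karoubi (ModuleCat.{u} R)) ℤ where
  X i := Limits.biproduct
    (fun a : {a : AlternatelyColouredSmoothing D // D.height a.state = i} => a.1.generator R G)
  d _ _ := 0

end Generators

end VirtualKhovanovLee

/-!
The tensor products of the idempotents `red` and `green` form a basis of the complex. It is indexed
by the states together with a compatible colouring, that is, a colouring of the strands which is
constant along each cycle of the state except for a change at every cut locus. On a vector of this
basis the differential only changes the state: it resmooths those `A`-smoothed crossings whose two
arcs have the same colour, with a coefficient `± 1` or `± 2`. Resmoothing such a crossing keeps the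
colouring compatible, so the complex splits along the colourings into cubes whose edges carry units
as weights.

A total order of the cycles is recorded by its volume form, an alternating form in the vectors of
the cycles. Along an edge of a cube the sign is the one that relates the volume form of the merged
state to the contraction of the other volume form by the difference of the vectors of the two cycles
that merge. Contractions anticommute, hence so do the faces of the cubes, and the differential
squares to zero.

Resmoothing a fixed monochromatic crossing is invertible, and its inverse contracts the cube of any
colouring that has such a crossing. What survives are the colourings with different colours at each
crossing. For these no crossing can be resmoothed, so they contribute summands of rank one, with
vanishing differentials.
-/

namespace VirtualKhovanovLee

/-! ### Cycles of permutations and transpositions -/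

section Permutations

open Equiv Equiv.Perm

variable {α : Type*} {f : Perm α} {x y u v : α}

theorem sameCycle_mem_of_mapsTo [Finite α] {A : Set α} (hA : Set.MapsTo f A A) (hx : x ∈ A)
    (h : f.SameCycle x y) : y ∈ A := by
  obtain ⟨n, rfl⟩ := h.exists_nat_pow_eq
  exact hA.perm_pow n hx

theorem exists_arc_of_sameCycle [Finite α] (hne : x ≠ y) (h : f.SameCycle x y) :
    ∃ A : Set α, x ∈ A ∧ y ∉ A ∧ (∀ a ∈ A, f.SameCycle x a) ∧
      ∀ a ∈ A, f a ≠ x ∧ (f a = y ∨ f a ∈ A) := by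
  classical
  have hex := h.exists_nat_pow_eq
  obtain ⟨hn, hmin⟩ := Nat.find_spec hex, fun m => Nat.find_min (m := m) hex
  set n := Nat.find hex
  have hpos : 0 < n := Nat.pos_of_ne_zero fun h0 => hne (by simpa [h0] using hn)
  refine ⟨{a | ∃ i < n, (f ^ i) x = a}, ⟨0, hpos, rfl⟩, fun ⟨i, hi, hiy⟩ => hmin i hi hiy, ?_, ?_⟩
  · rintro _ ⟨i, -, rfl⟩
    exact ⟨i, rfl⟩
  · rintro _ ⟨i, hi, rfl⟩
    rw [← mul_apply, ← pow_succ']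
    refine ⟨fun hx => hmin (n - (i + 1)) (by lia) ?_, ?_⟩
    · rw [← hn, ← Nat.sub_add_cancel hi, pow_add, mul_apply, hx, Nat.add_sub_cancel]
    · rcases Nat.lt_or_eq_of_le (Nat.succ_le_of_lt hi) with hlt | heq
      exacts [.inr ⟨i + 1, hlt, rfl⟩, .inl ((congrArg (fun k => (f ^ k) x) heq).trans hn)]

variable [DecidableEq α] [Finite α]

theorem not_sameCycle_swap_mul (hne : x ≠ y) (h : f.SameCycle x y) :
    ¬ (swap x y * f).SameCycle x y := by
  obtain ⟨A, hxA, hyA, -, hstep⟩ := exists_arc_of_sameCycle hne h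
  refine fun hc => hyA (sameCycle_mem_of_mapsTo (fun a ha => ?_) hxA hc)
  obtain ⟨hx, hy | hA⟩ := hstep a ha
  · rwa [mul_apply, hy, swap_apply_right]
  · rwa [mul_apply, swap_apply_of_ne_of_ne hx (ne_of_mem_of_not_mem hA hyA)]

theorem sameCycle_swap_mul (h : ¬ f.SameCycle x y) : (swap x y * f).SameCycle x y := by
  have hpow : ∀ i : ℕ, (swap x y * f).SameCycle x ((f ^ i) x) := by
    intro i
    induction i with
    | zero => rfl
    | succ i ih =>
      rw [pow_succ', mul_apply]
      by_cases hx : f ((f ^ i) x) = x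
      · rw [hx]
      · have hy : f ((f ^ i) x) ≠ y := by
          rintro rfl
          exact h (sameCycle_apply_right.2 SameCycle.rfl.pow_right)
        refine ih.trans ⟨1, ?_⟩
        rw [zpow_one, mul_apply, swap_apply_of_ne_of_ne hx hy]
  obtain ⟨i, hi⟩ := (show f.SameCycle x (f⁻¹ x) from ⟨-1, by simp⟩).exists_nat_pow_eq
  exact (hi ▸ hpow i).trans ⟨1, by simp⟩

theorem sameCycle_swap_mul_iff (h : ¬ f.SameCycle x y) {a b : α} :
    (swap x y * f).SameCycle a b ↔ f.SameCycle a b ∨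
      ((f.SameCycle a x ∨ f.SameCycle a y) ∧ (f.SameCycle b x ∨ f.SameCycle b y)) := by
  have hxy := sameCycle_swap_mul h
  have hstep : ∀ a, (swap x y * f).SameCycle a (f a) := by
    intro a
    refine SameCycle.trans (y := (swap x y * f) a) ⟨1, by simp⟩ ?_
    rw [mul_apply, swap_apply_def]
    split_ifs with hx hy
    exacts [hx ▸ hxy.symm, hy ▸ hxy, .rfl]
  have hsub : ∀ {a b}, f.SameCycle a b → (swap x y * f).SameCycle a b := fun {a _} =>
    sameCycle_mem_of_mapsTo (A := {b | (swap x y * f).SameCycle a b})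
      (fun c hc => SameCycle.trans hc (hstep c)) SameCycle.rfl
  constructor
  · refine sameCycle_mem_of_mapsTo (A := {b | f.SameCycle a b ∨
      ((f.SameCycle a x ∨ f.SameCycle a y) ∧ (f.SameCycle b x ∨ f.SameCycle b y))})
      (fun b hb => ?_) (.inl .rfl)
    have hfb : f.SameCycle b (f b) := ⟨1, by simp⟩
    simp only [Set.mem_ofPred_eq, mul_apply, swap_apply_def] at hb ⊢
    have htrans := @SameCycle.trans α f
    have hsymm := @SameCycle.symm α f
    have hrefl := SameCycle.refl f
    split_ifs <;> grind
  · rintro (hab | ⟨ha | ha, hb | hb⟩)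
    · exact hsub hab
    · exact hsub (ha.trans hb.symm)
    · exact (hsub ha).trans (hxy.trans (hsub hb.symm))
    · exact (hsub ha).trans (hxy.symm.trans (hsub hb.symm))
    · exact hsub (ha.trans hb.symm)

theorem not_sameCycle_swap_mul_swap_mul (hxu : f.SameCycle x u) (hvy : f.SameCycle v y)
    (hxy : ¬ f.SameCycle x y) (hne : x ≠ u) (hne' : v ≠ y) :
    ¬ (swap x y * (swap u v * f)).SameCycle x u := by
  -- The arcs from `x` to `u` and from `v` to `y` close up to a cycle that does not reach `u`.
  obtain ⟨A, hxA, huA, hA, hstepA⟩ := exists_arc_of_sameCycle hne hxu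
  obtain ⟨B, hvB, hyB, hB, hstepB⟩ := exists_arc_of_sameCycle hne' hvy
  have hdisj : ∀ {a b}, f.SameCycle x a → f.SameCycle v b → a ≠ b := by
    rintro a b ha hb rfl
    exact hxy (ha.trans (hb.symm.trans hvy))
  refine fun hc => (sameCycle_mem_of_mapsTo (A := A ∪ B) ?_ (.inl hxA) hc).elim huA
    fun huB => hdisj hxu (hB u huB) rfl
  rintro a (ha | ha)
  · obtain ⟨hx, hu | hfA⟩ := hstepA a ha
    · rw [mul_apply, mul_apply, hu, swap_apply_left,
        swap_apply_of_ne_of_ne (hdisj .rfl .rfl).symm hne']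
      exact .inr hvB
    · rw [mul_apply, mul_apply,
        swap_apply_of_ne_of_ne (ne_of_mem_of_not_mem hfA huA) (hdisj (hA _ hfA) .rfl),
        swap_apply_of_ne_of_ne hx (hdisj (hA _ hfA) hvy)]
      exact .inl hfA
  · obtain ⟨hv, hy | hfB⟩ := hstepB a ha
    · rw [mul_apply, mul_apply, hy, swap_apply_of_ne_of_ne (hdisj hxu hvy).symm hne'.symm,
        swap_apply_right]
      exact .inl hxA
    · rw [mul_apply, mul_apply, swap_apply_of_ne_of_ne (hdisj hxu (hB _ hfB)).symm hv,
        swap_apply_of_ne_of_ne (hdisj .rfl (hB _ hfB)).symm (ne_of_mem_of_not_mem hfB hyB)]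
      exact .inr hfB

end Permutations

section Involutions

variable {α : Type*} {a b : Equiv.Perm α}

theorem not_sameCycle_mul_apply_of_involutions (ha : a * a = 1) (hb : b * b = 1)
    (ha' : ∀ x, a x ≠ x) (hb' : ∀ x, b x ≠ x) (x : α) : ¬ (a * b).SameCycle x (a x) := by
  rintro ⟨n, hn⟩
  have hconj : SemiconjBy a (a * b) (a * b)⁻¹ := by
    rw [SemiconjBy, mul_inv_rev, inv_eq_of_mul_eq_one_left ha, inv_eq_of_mul_eq_one_left hb,
      mul_assoc, ha, mul_one, ← mul_assoc, ha, one_mul]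
  have hreflect (m : ℤ) : a (((a * b) ^ m) x) = ((a * b) ^ (n - m)) x := by
    rw [← Equiv.Perm.mul_apply, (hconj.zpow_right m).eq, Equiv.Perm.mul_apply, ← hn,
      ← Equiv.Perm.mul_apply, inv_zpow', ← zpow_add, neg_add_eq_sub]
  obtain ⟨m, rfl | rfl⟩ := Int.even_or_odd' n
  · exact ha' (((a * b) ^ m) x) (by rw [hreflect]; congr 2; ring)
  · refine hb' (((a * b) ^ m) x) ?_
    have hab : b = a * (a * b) := by rw [← mul_assoc, ha, one_mul]
    calc b (((a * b) ^ m) x) = a (((a * b) ^ (m + 1)) x) := by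
          rw [zpow_add_one, (Commute.self_zpow (a * b) m).symm.eq]
          exact congrArg (fun g : Equiv.Perm α => g (((a * b) ^ m) x)) hab
      _ = ((a * b) ^ m) x := by rw [hreflect]; congr 2; ring

theorem exists_alternating_of_involutions (ha : a * a = 1) (hb : b * b = 1)
    (ha' : ∀ x, a x ≠ x) (hb' : ∀ x, b x ≠ x) :
    ∃ p : α → Prop, ∀ x, (p (a x) ↔ ¬ p x) ∧ (p (b x) ↔ ¬ p x) := by
  -- Each orbit of the dihedral group of `a` and `b` consists of two cycles of `a * b`, exchanged
  -- by `a` and by `b`; compare them in some linear order of all cycles.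
  let cycle : α → Quotient (Equiv.Perm.SameCycle.setoid (a * b)) := Quotient.mk _
  classical
  let _ : LinearOrder (Quotient (Equiv.Perm.SameCycle.setoid (a * b))) :=
    linearOrderOfSTO WellOrderingRel
  have haa (x : α) : a (a x) = x := congrArg (fun g : Equiv.Perm α => g x) ha
  have hbb (x : α) : b (b x) = x := congrArg (fun g : Equiv.Perm α => g x) hb
  have hcycle (x : α) : cycle (a (b x)) = cycle x :=
    Quotient.sound (Equiv.Perm.SameCycle.symm ⟨1, by simp⟩)
  have hne (x : α) : cycle x ≠ cycle (a x) := fun h =>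
    not_sameCycle_mul_apply_of_involutions ha hb ha' hb' x (Quotient.exact h)
  have hb_cycle (x : α) : cycle (b x) = cycle (a x) := by rw [← hcycle (b x), hbb]
  refine ⟨fun x => cycle x < cycle (a x), fun x => ⟨?_, ?_⟩⟩
  · simp only [haa, not_lt, (hne x).symm.le_iff_lt]
  · simp only [hcycle, hb_cycle, not_lt, (hne x).symm.le_iff_lt]

end Involutions

variable {ι : Type}

/-! ### Compatible colourings -/

/-- The opposite colour: the one taken after crossing a cut locus. -/
def Colour.other : Colour → Colour
  | .red => .green
  | .green => .red

theorem Colour.ne_iff {a b : Colour} : a ≠ b ↔ a = b.other := by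
  cases a <;> cases b <;> decide

namespace VirtualLinkDiagram

variable {D : VirtualLinkDiagram ι} {s s' : State ι}

theorem cycleOf_eq_iff {h k : HalfEdge ι} :
    D.cycleOf s h = D.cycleOf s k ↔ ∃ n, D.CutPath s h k n :=
  Quotient.eq (r := D.cycleSetoid s)

theorem cycleOf_smooth (h : HalfEdge ι) : D.cycleOf s (D.smooth s h) = D.cycleOf s h :=
  (cycleOf_eq_iff.2 ⟨_, CutPath.refl.smooth⟩).symm

theorem cycleOf_glue (h : HalfEdge ι) : D.cycleOf s (D.glue h) = D.cycleOf s h :=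
  (cycleOf_eq_iff.2 ⟨_, CutPath.refl.glue⟩).symm

theorem smooth_ne (h : HalfEdge ι) : D.smooth s h ≠ h := by
  rcases h with ⟨c, o, e⟩
  simp only [smooth]
  split <;> simp

theorem glue_ne (h : HalfEdge ι) : D.glue h ≠ h := by
  rcases h with ⟨c, o, _ | _⟩ <;> simp [glue]

theorem smooth_fst (h : HalfEdge ι) : (D.smooth s h).1 = h.1 := by
  rcases h with ⟨c, o, e⟩
  simp only [smooth]
  split <;> rfl

theorem smooth_congr {h : HalfEdge ι} (hs : s h.1 = s' h.1) : D.smooth s h = D.smooth s' h := by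
  rcases h with ⟨c, o, e⟩
  simp only [smooth, show s c = s' c from hs]

theorem smooth_eq_smooth_not {c : ι} (hs : s c ≠ s' c) (o e : Bool) :
    D.smooth s' (c, o, e) = D.smooth s (c, o, !e) := by
  rw [← Bool.not_eq] at hs
  simp only [smooth, ← hs]
  cases s c <;> cases D.positive c <;> simp

theorem inward_smooth (h : HalfEdge ι) : D.Inward (D.smooth s h) ↔ ¬ D.Inward h := by
  rcases h with ⟨c, o, e⟩
  simp only [smooth]
  split <;> simp only [Inward] <;> cases o <;> cases D.positive c <;> simp

variable (D) in
/-- A colouring of the ends that is constant along the strands of the state `s` except that it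
changes at each cut locus: the colour of an idempotent transported along a cycle. -/
structure Compatible (s : State ι) (χ : HalfEdge ι → Colour) : Prop where
  smooth : ∀ h, χ (D.smooth s h) = χ h
  glue : ∀ h, χ (D.glue h) = χ h ↔ ¬ D.IsCut h

namespace Compatible

variable {χ χ' : HalfEdge ι → Colour} {h k : HalfEdge ι}

theorem eq_iff_even (hχ : D.Compatible s χ) {n : ℕ} (p : D.CutPath s h k n) :
    χ k = χ h ↔ Even n := by
  induction p with
  | refl => simp
  | smooth _ ih => rw [hχ.smooth, ih]
  | @glue k n _ ih =>
    by_cases hk : D.IsCut k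
    · have hne : χ (D.glue k) ≠ χ k := fun h => (hχ.glue k).1 h hk
      rw [if_pos hk, Nat.even_add_one, ← ih, Colour.ne_iff.1 hne]
      cases χ k <;> cases χ h <;> decide
    · rw [if_neg hk, add_zero, (hχ.glue k).2 hk, ih]

theorem barred_iff (hχ : D.Compatible s χ) (hk : D.cycleOf s h = D.cycleOf s k) :
    D.Barred s h k ↔ χ h ≠ χ k := by
  rw [Ne, eq_comm]
  constructor
  · rintro ⟨n, hn, p⟩
    rwa [hχ.eq_iff_even p, Nat.not_even_iff_odd]
  · obtain ⟨n, p⟩ := cycleOf_eq_iff.1 hk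
    rw [hχ.eq_iff_even p, Nat.not_even_iff_odd]
    exact fun hn => ⟨n, hn, p⟩

theorem eq_iff (hχ : D.Compatible s χ) (hχ' : D.Compatible s χ')
    (hk : D.cycleOf s h = D.cycleOf s k) : χ h = χ k ↔ χ' h = χ' k :=
  not_iff_not.1 ((hχ.barred_iff hk).symm.trans (hχ'.barred_iff hk))

theorem apply_eq (hχ : D.Compatible s χ) (hχ' : D.Compatible s χ')
    (hk : D.cycleOf s h = D.cycleOf s k) (e : χ h = χ' h) : χ k = χ' k := by
  have := hχ.eq_iff hχ' hk
  revert this e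
  cases χ h <;> cases χ' h <;> cases χ k <;> cases χ' k <;> simp

end Compatible

variable (D) in
theorem exists_compatible (s : State ι) : ∃ χ, D.Compatible s χ := by
  classical
  obtain ⟨p, hp⟩ := exists_alternating_of_involutions
    (a := Function.Involutive.toPerm _ (D.smooth_smooth s))
    (b := Function.Involutive.toPerm _ D.glue_glue)
    (Equiv.ext (D.smooth_smooth s)) (Equiv.ext D.glue_glue) smooth_ne glue_ne
  have hsmooth (h : HalfEdge ι) : p (D.smooth s h) ↔ ¬ p h := (hp h).1
  have hglue (h : HalfEdge ι) : p (D.glue h) ↔ ¬ p h := (hp h).2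
  -- Red where the alternating direction of the cycle agrees with the source-sink orientation.
  refine ⟨fun h => if p h ↔ D.Inward h then .red else .green, fun h => ?_, fun h => ?_⟩
  · simp only [hsmooth, inward_smooth, not_iff_not]
  · simp only [hglue, IsCut]
    by_cases hph : p h <;> by_cases h₁ : D.Inward h <;> by_cases h₂ : D.Inward (D.glue h) <;>
      simp [hph, h₁, h₂]

theorem exists_compatible_of_star {star : D.CrossingCycle s → HalfEdge ι}
    (hstar : ∀ z, D.cycleOf s (star z) = z) (k : D.CrossingCycle s → Colour) :
    ∃ χ, D.Compatible s χ ∧ ∀ z, χ (star z) = k z := by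
  classical
  obtain ⟨χ, hχ⟩ := D.exists_compatible s
  refine ⟨fun h => if χ h = χ (star (D.cycleOf s h)) then k (D.cycleOf s h)
    else (k (D.cycleOf s h)).other, ⟨fun h => ?_, fun h => ?_⟩, fun z => ?_⟩
  · simp only [cycleOf_smooth, hχ.smooth]
  · simp only [cycleOf_glue, ← hχ.glue]
    generalize χ (star (D.cycleOf s h)) = a
    generalize k (D.cycleOf s h) = b
    cases χ (D.glue h) <;> cases χ h <;> cases a <;> cases b <;> decide
  · simp [hstar]

/-! ### The flow of a coloured state -/

variable (D) in
/-- The strand through `h`, directed by the source-sink orientation where it is red and by the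
reverse orientation where it is green, runs towards the crossing at `h`. Smoothing arcs and
semi-arcs are both directed consistently, so this orients every cycle. -/
def Entering (χ : HalfEdge ι → Colour) (h : HalfEdge ι) : Prop := D.Inward h ↔ χ h = .red

variable {χ : HalfEdge ι → Colour}

namespace Compatible

theorem entering_smooth (hχ : D.Compatible s χ) (h : HalfEdge ι) :
    D.Entering χ (D.smooth s h) ↔ ¬ D.Entering χ h := by
  rw [Entering, Entering, inward_smooth, hχ.smooth]; tauto

theorem entering_glue (hχ : D.Compatible s χ) (h : HalfEdge ι) :
    D.Entering χ (D.glue h) ↔ ¬ D.Entering χ h := by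
  have hglue := hχ.glue h
  rw [IsCut] at hglue
  rw [Entering, Entering]
  revert hglue
  by_cases h₁ : D.Inward h <;> by_cases h₂ : D.Inward (D.glue h) <;>
    cases χ (D.glue h) <;> cases χ h <;> simp [h₁, h₂]

open Classical in
/-- The permutation that moves each end one step along its cycle, in the direction given by the
colouring. -/
noncomputable def flow (hχ : D.Compatible s χ) : Equiv.Perm (HalfEdge ι) where
  toFun h := if D.Entering χ h then D.smooth s h else D.glue h
  invFun h := if D.Entering χ h then D.glue h else D.smooth s h
  left_inv h := by
    by_cases hh : D.Entering χ h <;>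
      simp [hh, hχ.entering_smooth, hχ.entering_glue, D.smooth_smooth, D.glue_glue]
  right_inv h := by
    by_cases hh : D.Entering χ h <;>
      simp [hh, hχ.entering_smooth, hχ.entering_glue, D.smooth_smooth, D.glue_glue]

theorem flow_of_entering (hχ : D.Compatible s χ) {h : HalfEdge ι} (hh : D.Entering χ h) :
    hχ.flow h = D.smooth s h := if_pos hh

theorem flow_of_not_entering (hχ : D.Compatible s χ) {h : HalfEdge ι} (hh : ¬ D.Entering χ h) :
    hχ.flow h = D.glue h := if_neg hh

theorem cycleOf_flow (hχ : D.Compatible s χ) (h : HalfEdge ι) :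
    D.cycleOf s (hχ.flow h) = D.cycleOf s h := by
  by_cases hh : D.Entering χ h
  · rw [hχ.flow_of_entering hh, cycleOf_smooth]
  · rw [hχ.flow_of_not_entering hh, cycleOf_glue]

theorem sameCycle_flow_smooth (hχ : D.Compatible s χ) (h : HalfEdge ι) :
    hχ.flow.SameCycle h (D.smooth s h) := by
  by_cases hh : D.Entering χ h
  · exact ⟨1, by rw [zpow_one, hχ.flow_of_entering hh]⟩
  · refine Equiv.Perm.SameCycle.symm ⟨1, ?_⟩
    rw [zpow_one, hχ.flow_of_entering ((hχ.entering_smooth h).2 hh), D.smooth_smooth]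

theorem sameCycle_flow_glue (hχ : D.Compatible s χ) (h : HalfEdge ι) :
    hχ.flow.SameCycle h (D.glue h) := by
  by_cases hh : D.Entering χ h
  · refine Equiv.Perm.SameCycle.symm ⟨1, ?_⟩
    rw [zpow_one, hχ.flow_of_not_entering (by rwa [hχ.entering_glue, not_not]), D.glue_glue]
  · exact ⟨1, by rw [zpow_one, hχ.flow_of_not_entering hh]⟩

theorem sameCycle_flow_iff [Finite ι] (hχ : D.Compatible s χ) {h k : HalfEdge ι} :
    hχ.flow.SameCycle h k ↔ D.cycleOf s h = D.cycleOf s k := by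
  constructor
  · exact sameCycle_mem_of_mapsTo (A := {k | D.cycleOf s h = D.cycleOf s k})
      (fun k hk => hk.trans (hχ.cycleOf_flow k).symm) rfl
  · rw [cycleOf_eq_iff]
    rintro ⟨n, p⟩
    induction p with
    | refl => rfl
    | smooth _ ih => exact ih.trans (hχ.sameCycle_flow_smooth _)
    | glue _ ih => exact ih.trans (hχ.sameCycle_flow_glue _)

end Compatible

end VirtualLinkDiagram

/-! ### Resmoothing a crossing of a single colour -/

namespace VirtualLinkDiagram

variable {D : VirtualLinkDiagram ι} {s s' : State ι} {χ : HalfEdge ι → Colour} {c c' : ι}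

variable (D) in
/-- The ends `site₁ c` (for `true`) and `site₂ c` (for `false`), in a form that allows statements
symmetric in the two. -/
def site (c : ι) (e : Bool) : HalfEdge ι := (c, !D.positive c, e)

theorem entering_site (e : Bool) : D.Entering χ (D.site c e) ↔ χ (D.site c e) = .green := by
  simp only [Entering, site, Inward]
  cases χ (c, !D.positive c, e) <;> simp

theorem colour_site (hc : χ (D.site₁ c) = χ (D.site₂ c)) (e : Bool) :
    χ (D.site c e) = χ (D.site₁ c) := by
  cases e
  exacts [hc.symm, rfl]

theorem Compatible.eq_site₁ (hχ : D.Compatible s χ) (hc : χ (D.site₁ c) = χ (D.site₂ c))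
    (o e : Bool) : χ (c, o, e) = χ (D.site₁ c) := by
  by_cases ho : o = !D.positive c
  · exact ho ▸ colour_site hc e
  · obtain rfl : o = D.positive c := by revert ho; cases o <;> cases D.positive c <;> decide
    rw [← hχ.smooth]
    simp only [VirtualLinkDiagram.smooth]
    split <;> exact colour_site hc _

variable (D) in
/-- An edge of the cube of states along which the colour vectors of `χ` survive: the states `s` and
`s'` differ exactly at the crossing `c`, and the colouring `χ` is compatible with both of them and
has a single colour at `c`. -/
structure MonochromaticEdge (χ : HalfEdge ι → Colour) (c : ι) (s s' : State ι) : Prop where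
  compatible : D.Compatible s χ
  mono : χ (D.site₁ c) = χ (D.site₂ c)
  agree : ∀ d, d ≠ c → s' d = s d
  ne : s c ≠ s' c

open Classical in
variable (D) in
/-- The end at which the arc through `h` leaves the crossing. -/
noncomputable def leave (χ : HalfEdge ι → Colour) (s : State ι) (h : HalfEdge ι) : HalfEdge ι :=
  if D.Entering χ h then D.smooth s h else h

theorem leave_fst (h : HalfEdge ι) : (D.leave χ s h).1 = h.1 := by
  rw [leave]
  split
  exacts [smooth_fst h, rfl]

theorem cycleOf_leave (h : HalfEdge ι) : D.cycleOf s (D.leave χ s h) = D.cycleOf s h := by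
  rw [leave]
  split
  exacts [cycleOf_smooth h, rfl]

theorem leave_congr {h : HalfEdge ι} (hs : s h.1 = s' h.1) : D.leave χ s h = D.leave χ s' h := by
  rw [leave, leave, smooth_congr hs]

theorem Compatible.not_entering_leave (hχ : D.Compatible s χ) (h : HalfEdge ι) :
    ¬ D.Entering χ (D.leave χ s h) := by
  rw [leave]
  split
  · rwa [hχ.entering_smooth, not_not]
  · assumption

theorem leave_site_of_red {e : Bool} (hr : χ (D.site c e) = .red) :
    D.leave χ s (D.site c e) = D.site c e :=
  if_neg (by rw [entering_site, hr]; decide)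

theorem leave_site_of_green (hg : ∀ e, χ (D.site c e) = .green) (hs : s c ≠ s' c) (e : Bool) :
    D.leave χ s' (D.site c e) = D.leave χ s (D.site c !e) := by
  rw [leave, leave, if_pos ((entering_site _).2 (hg _)), if_pos ((entering_site _).2 (hg _))]
  exact smooth_eq_smooth_not hs _ e

theorem cycleOf_leave_site (hc : χ (D.site₁ c) = χ (D.site₂ c)) (hs : s c ≠ s' c) (e : Bool) :
    D.cycleOf s' (D.leave χ s (D.site c e)) =
      D.cycleOf s' (D.site c (e ^^ decide (χ (D.site₁ c) = .green))) := by
  cases hx : χ (D.site₁ c)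
  · rw [leave_site_of_red ((colour_site hc e).trans hx)]
    simp
  · rw [leave_site_of_green (fun e => (colour_site hc e).trans hx) hs.symm, cycleOf_leave]
    simp

theorem leave_site_ne (hc : χ (D.site₁ c) = χ (D.site₂ c)) (e : Bool) :
    D.leave χ s (D.site c e) ≠ D.leave χ s (D.site c !e) := by
  have hne : D.site c e ≠ D.site c !e := by simp [site]
  have hent : D.Entering χ (D.site c e) ↔ D.Entering χ (D.site c !e) := by
    rw [entering_site, entering_site, colour_site hc, colour_site hc]
  rw [leave, leave]
  by_cases h : D.Entering χ (D.site c e)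
  · rw [if_pos h, if_pos (hent.1 h)]
    exact fun heq => hne (Function.Involutive.injective (D.smooth_smooth s) heq)
  · rwa [if_neg h, if_neg (hent.not.1 h)]

namespace MonochromaticEdge

theorem symm (E : D.MonochromaticEdge χ c s s') : D.MonochromaticEdge χ c s' s := by
  refine ⟨⟨fun h => ?_, E.compatible.glue⟩, E.mono, fun d hd => (E.agree d hd).symm, E.ne.symm⟩
  by_cases hc : h.1 = c
  · rcases h with ⟨_, o, e⟩
    obtain rfl := hc
    simp only [smooth]
    split <;> simp only [E.compatible.eq_site₁ E.mono]
  · rw [smooth_congr (E.agree h.1 hc), E.compatible.smooth]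

theorem exists_smooth_eq_leave (E : D.MonochromaticEdge χ c s s') {o : Bool} (e : Bool)
    (hent : D.Entering χ (c, o, e)) : ∃ f, D.smooth s (c, o, e) = D.leave χ s (D.site c f) ∧
      D.smooth s' (c, o, e) = D.leave χ s (D.site c !f) := by
  rw [smooth_eq_smooth_not E.ne]
  rw [Entering, E.compatible.eq_site₁ E.mono] at hent
  cases hx : χ (D.site₁ c)
  · obtain rfl : o = D.positive c := by simpa [hx, Inward] using hent
    have hleave (f : Bool) : D.leave χ s (D.site c f) = D.site c f :=
      leave_site_of_red ((colour_site E.mono f).trans hx)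
    simp only [hleave, smooth]
    split
    exacts [⟨!e, rfl, rfl⟩, ⟨e, rfl, rfl⟩]
  · obtain rfl : o = !D.positive c := Bool.eq_not.2 (by simpa [hx, Inward] using hent)
    have hleave (f : Bool) : D.leave χ s (D.site c f) = D.smooth s (D.site c f) :=
      if_pos ((entering_site f).2 ((colour_site E.mono f).trans hx))
    exact ⟨e, (hleave e).symm, (hleave !e).symm⟩

theorem flow_eq [DecidableEq ι] (E : D.MonochromaticEdge χ c s s') (e : Bool) :
    E.symm.compatible.flow = Equiv.swap (D.leave χ s (D.site c e)) (D.leave χ s (D.site c !e)) *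
      E.compatible.flow := by
  have hχ := E.compatible
  ext1 h
  rw [Equiv.Perm.mul_apply]
  by_cases hh : D.Entering χ h
  · rw [hχ.flow_of_entering hh, E.symm.compatible.flow_of_entering hh]
    by_cases hc : h.1 = c
    · rcases h with ⟨_, o, f⟩
      obtain rfl := hc
      obtain ⟨g, hg, hg'⟩ := E.exists_smooth_eq_leave f hh
      rw [hg, hg']
      obtain rfl | rfl : g = e ∨ g = !e := by cases g <;> cases e <;> decide
      · rw [Equiv.swap_apply_left]
      · rw [Equiv.swap_apply_right, Bool.not_not]
    · rw [smooth_congr (E.agree h.1 hc), Equiv.swap_apply_of_ne_of_ne] <;>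
      · intro heq
        have := congrArg Prod.fst heq
        rw [leave_fst, smooth_fst] at this
        exact hc this
  · rw [hχ.flow_of_not_entering hh, E.symm.compatible.flow_of_not_entering hh,
      Equiv.swap_apply_of_ne_of_ne] <;>
    · intro heq
      refine hχ.not_entering_leave _ (heq ▸ (hχ.entering_glue h).2 hh)

variable [Finite ι]

theorem cycleOf_site_eq_iff (E : D.MonochromaticEdge χ c s s') :
    D.cycleOf s' (D.site₁ c) = D.cycleOf s' (D.site₂ c) ↔
      D.cycleOf s (D.site₁ c) ≠ D.cycleOf s (D.site₂ c) := by
  classical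
  have hsites : D.cycleOf s' (D.site₁ c) = D.cycleOf s' (D.site₂ c) ↔
      D.cycleOf s' (D.leave χ s (D.site c true)) = D.cycleOf s' (D.leave χ s (D.site c false)) := by
    rw [cycleOf_leave_site E.mono E.ne, cycleOf_leave_site E.mono E.ne]
    cases decide (χ (D.site₁ c) = .green)
    exacts [Iff.rfl, eq_comm]
  have hflow := E.flow_eq true
  rw [hsites, ← E.symm.compatible.sameCycle_flow_iff, hflow,
    ← cycleOf_leave (χ := χ) (D.site₁ c), ← cycleOf_leave (χ := χ) (D.site₂ c), Ne,
    ← E.compatible.sameCycle_flow_iff]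
  exact ⟨fun h' h => not_sameCycle_swap_mul (leave_site_ne E.mono true) h h', sameCycle_swap_mul⟩

theorem cycleOf_eq_iff_of_merge (E : D.MonochromaticEdge χ c s s')
    (hm : D.cycleOf s (D.site₁ c) ≠ D.cycleOf s (D.site₂ c)) {a b : HalfEdge ι} :
    D.cycleOf s' a = D.cycleOf s' b ↔ D.cycleOf s a = D.cycleOf s b ∨
      ((D.cycleOf s a = D.cycleOf s (D.site₁ c) ∨ D.cycleOf s a = D.cycleOf s (D.site₂ c)) ∧
        (D.cycleOf s b = D.cycleOf s (D.site₁ c) ∨ D.cycleOf s b = D.cycleOf s (D.site₂ c))) := by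
  classical
  rw [← cycleOf_leave (χ := χ) (D.site₁ c), ← cycleOf_leave (χ := χ) (D.site₂ c)] at hm ⊢
  rw [Ne, ← E.compatible.sameCycle_flow_iff] at hm
  simp only [← E.compatible.sameCycle_flow_iff, ← E.symm.compatible.sameCycle_flow_iff]
  rw [E.flow_eq true]
  exact sameCycle_swap_mul_iff hm

end MonochromaticEdge

/-! ### Two crossings between the same cycles -/

variable (D) in
/-- The arcs at the crossing `c` lie on the same cycles as the arcs at `c'`, in the same order if
`β = false` and in the opposite order if `β = true`. -/
def Paired (s : State ι) (c c' : ι) (β : Bool) : Prop :=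
  ∀ e, D.cycleOf s (D.site c e) = D.cycleOf s (D.site c' (e ^^ β))

variable [Finite ι]

theorem MonochromaticEdge.exists_paired (E : D.MonochromaticEdge χ c s s')
    (hc : D.cycleOf s (D.site₁ c) ≠ D.cycleOf s (D.site₂ c))
    (hc' : D.cycleOf s (D.site₁ c') ≠ D.cycleOf s (D.site₂ c'))
    (heq : D.cycleOf s' (D.site₁ c') = D.cycleOf s' (D.site₂ c')) : ∃ β, D.Paired s c c' β := by
  rcases (E.cycleOf_eq_iff_of_merge hc).1 heq with h | ⟨h₁ | h₁, h₂ | h₂⟩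
  · exact absurd h hc'
  · exact absurd (h₁.trans h₂.symm) hc'
  · exact ⟨false, fun e => by cases e; exacts [h₂.symm, h₁.symm]⟩
  · exact ⟨true, fun e => by cases e; exacts [h₁.symm, h₂.symm]⟩
  · exact absurd (h₁.trans h₂.symm) hc'

theorem Paired.eq_iff_of_resmooth {t : State ι} {β β' : Bool} (hp : D.Paired s c c' β)
    (hp' : D.Paired s' c c' β') (hcc : c ≠ c')
    (hm : D.cycleOf s (D.site₁ c) ≠ D.cycleOf s (D.site₂ c))
    (E' : D.MonochromaticEdge χ c' s t) (E : D.MonochromaticEdge χ c t s') :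
    β = β' ↔ χ (D.site₁ c) ≠ χ (D.site₁ c') := by
  classical
  set γ := decide (χ (D.site₁ c) = .green) with hγ
  set γ' := decide (χ (D.site₁ c') = .green) with hγ'
  have hsc : s c = t c := (E'.agree c hcc).symm
  have hsc' : s' c' = t c' := E.agree c' hcc.symm
  have hne (d : HalfEdge ι) (d' : HalfEdge ι) (hd : d.1 = c) (hd' : d'.1 = c') :
      D.leave χ s d ≠ D.leave χ s d' := fun h => hcc (by
    have := congrArg Prod.fst h
    rwa [leave_fst, leave_fst, hd, hd'] at this)
  have hflow : E.symm.compatible.flow =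
      Equiv.swap (D.leave χ s (D.site c true)) (D.leave χ s (D.site c false)) *
      (Equiv.swap (D.leave χ s (D.site c' (true ^^ β))) (D.leave χ s (D.site c' (false ^^ β))) *
        E'.compatible.flow) := by
    rw [E.flow_eq true, E'.flow_eq (true ^^ β), leave_congr (s := t) (s' := s) hsc.symm,
      leave_congr (s := t) (s' := s) hsc.symm]
    cases β <;> rfl
  have hcycle {h k : HalfEdge ι} : E'.compatible.flow.SameCycle (D.leave χ s h) (D.leave χ s k) ↔
      D.cycleOf s h = D.cycleOf s k := by
    rw [E'.compatible.sameCycle_flow_iff, cycleOf_leave, cycleOf_leave]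
  have key := not_sameCycle_swap_mul_swap_mul (hcycle.2 (hp true)) (hcycle.2 (hp false).symm)
    (hcycle.not.2 hm) (hne _ _ rfl rfl) (hne _ _ rfl rfl).symm
  rw [← hflow, E.symm.compatible.sameCycle_flow_iff,
    cycleOf_leave_site E.mono (hsc ▸ E.ne), cycleOf_leave_site E'.mono (hsc' ▸ E'.ne),
    hp' _, ← hγ, ← hγ'] at key
  have hβ : ((true ^^ γ) ^^ β') ≠ ((true ^^ β) ^^ γ') := fun h => key (by rw [h])
  have hcolour : χ (D.site₁ c) ≠ χ (D.site₁ c') ↔ γ ≠ γ' := by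
    rw [hγ, hγ']
    cases χ (D.site₁ c) <;> cases χ (D.site₁ c') <;> decide
  rw [hcolour]
  revert hβ
  cases β <;> cases β' <;> cases γ <;> cases γ' <;> decide

end VirtualLinkDiagram

/-! ### Cycles away from the resmoothed crossing -/

namespace VirtualLinkDiagram

/-- The ends of the semi-arcs, and one point on each component without crossings: the domain of a
colouring of all cycles. -/
abbrev Point (D : VirtualLinkDiagram ι) : Type := HalfEdge ι ⊕ Fin D.circles

variable {D : VirtualLinkDiagram ι} {s s' : State ι} {χ : HalfEdge ι → Colour} {c : ι}

variable (D) in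
/-- The cycle of the state `s` through a point. -/
def cycleThrough (s : State ι) : D.Point → D.Cycle s := Sum.map (D.cycleOf s) id

@[simp] theorem cycleThrough_inl (h : HalfEdge ι) :
    D.cycleThrough s (.inl h) = .inl (D.cycleOf s h) := rfl

@[simp] theorem cycleThrough_inr (i : Fin D.circles) : D.cycleThrough s (.inr i) = .inr i := rfl

variable (D) in
theorem cycleThrough_surjective (s : State ι) : Function.Surjective (D.cycleThrough s) :=
  Function.Surjective.sumMap Quotient.mk_surjective Function.surjective_id

variable (D) in
/-- The cycle of the state `s` through `q` does not meet the crossing `c`. -/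
def Avoids (c : ι) (s : State ι) (q : D.Point) : Prop :=
  D.cycleThrough s q ≠ .inl (D.cycleOf s (D.site₁ c)) ∧
    D.cycleThrough s q ≠ .inl (D.cycleOf s (D.site₂ c))

theorem unaffected_iff {p : D.Cycle s × D.Cycle s'} :
    D.Unaffected c s s' p ↔
      ∃ q, D.Avoids c s q ∧ D.cycleThrough s q = p.1 ∧ D.cycleThrough s' q = p.2 := by
  rcases p with ⟨z | i, z' | j⟩
  · rw [Sum.exists]
    simp only [Unaffected, Avoids, cycleThrough_inl, cycleThrough_inr, Sum.inl.injEq, ne_eq,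
      reduceCtorEq, and_false, exists_false, or_false, ← exists_and_left]
    refine exists_congr fun h => ⟨?_, ?_⟩
    · rintro ⟨h₁, h₂, rfl, rfl⟩
      exact ⟨⟨h₁, h₂⟩, rfl, rfl⟩
    · rintro ⟨⟨h₁, h₂⟩, rfl, rfl⟩
      exact ⟨h₁, h₂, rfl, rfl⟩
  all_goals simp [Unaffected, Avoids]

namespace MonochromaticEdge

variable [Finite ι]

theorem cycleThrough_eq_iff_of_merge (E : D.MonochromaticEdge χ c s s')
    (hm : D.cycleOf s (D.site₁ c) ≠ D.cycleOf s (D.site₂ c)) {a b : D.Point} :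
    D.cycleThrough s' a = D.cycleThrough s' b ↔
      D.cycleThrough s a = D.cycleThrough s b ∨ ¬ D.Avoids c s a ∧ ¬ D.Avoids c s b := by
  rcases a with a | a <;> rcases b with b | b
  · simp only [cycleThrough_inl, Sum.inl.injEq, Avoids, not_and_or, not_not, ne_eq]
    exact E.cycleOf_eq_iff_of_merge hm
  all_goals simp [Avoids]

theorem avoids_iff (E : D.MonochromaticEdge χ c s s') {q : D.Point} :
    D.Avoids c s' q ↔ D.Avoids c s q := by
  wlog hm : D.cycleOf s (D.site₁ c) ≠ D.cycleOf s (D.site₂ c) generalizing s s'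
  · exact (this E.symm (E.symm.cycleOf_site_eq_iff.1 (not_not.1 hm))).symm
  have h₁ := E.cycleThrough_eq_iff_of_merge hm (a := q) (b := .inl (D.site₁ c))
  have h₂ := E.cycleThrough_eq_iff_of_merge hm (a := q) (b := .inl (D.site₂ c))
  simp only [cycleThrough_inl] at h₁ h₂
  rw [Avoids, Ne, Ne, h₁, h₂]
  simp only [Avoids, cycleThrough_inl]
  tauto

theorem cycleThrough_eq_iff_of_avoids (E : D.MonochromaticEdge χ c s s') {q r : D.Point}
    (hq : D.Avoids c s q) :
    D.cycleThrough s' q = D.cycleThrough s' r ↔ D.cycleThrough s q = D.cycleThrough s r := by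
  wlog hm : D.cycleOf s (D.site₁ c) ≠ D.cycleOf s (D.site₂ c) generalizing s s'
  · exact (this E.symm (E.avoids_iff.2 hq) (E.symm.cycleOf_site_eq_iff.1 (not_not.1 hm))).symm
  · simp [E.cycleThrough_eq_iff_of_merge hm, hq]

end MonochromaticEdge

theorem Compatible.mono_of_split (hχ : D.Compatible s χ) (hs : ∀ d, d ≠ c → s' d = s d)
    (hne : s c ≠ s' c) (h : D.cycleOf s (D.site₁ c) = D.cycleOf s (D.site₂ c))
    (h' : D.cycleOf s' (D.site₁ c) ≠ D.cycleOf s' (D.site₂ c)) :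
    χ (D.site₁ c) = χ (D.site₂ c) := by
  classical
  -- Colour the two new cycles so that the crossing is red, and read the colouring in `s`.
  let star (z : D.CrossingCycle s') : HalfEdge ι :=
    if z = D.cycleOf s' (D.site₁ c) then D.site₁ c
    else if z = D.cycleOf s' (D.site₂ c) then D.site₂ c else z.out
  have hstar (z) : D.cycleOf s' (star z) = z := by
    simp only [star]
    split_ifs with h₁ h₂
    exacts [h₁.symm, h₂.symm, Quotient.out_eq _]
  obtain ⟨χ', hχ', hred⟩ := exists_compatible_of_star hstar fun _ => .red
  have h₁ : χ' (D.site₁ c) = .red := by simpa [star] using hred (D.cycleOf s' (D.site₁ c))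
  have h₂ : χ' (D.site₂ c) = .red := by simpa [star, h'.symm] using hred (D.cycleOf s' (D.site₂ c))
  have E : D.MonochromaticEdge χ' c s' s :=
    ⟨hχ', h₁.trans h₂.symm, fun d hd => (hs d hd).symm, hne.symm⟩
  exact (hχ.eq_iff E.symm.compatible h).2 E.mono

variable (D) in
/-- The one or two cycles of the state `s` that meet the crossing `c`. -/
noncomputable def siteCycles (c : ι) (s : State ι) : Finset (D.Cycle s) :=
  {.inl (D.cycleOf s (D.site₁ c)), .inl (D.cycleOf s (D.site₂ c))}

theorem cycleThrough_notMem_siteCycles {q : D.Point} :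
    D.cycleThrough s q ∉ D.siteCycles c s ↔ D.Avoids c s q := by
  simp [siteCycles, Avoids]

theorem Unaffected.fst_notMem_siteCycles {p : D.Cycle s × D.Cycle s'}
    (hp : D.Unaffected c s s' p) : p.1 ∉ D.siteCycles c s := by
  obtain ⟨q, hq, hq₁, -⟩ := unaffected_iff.1 hp
  rwa [← hq₁, cycleThrough_notMem_siteCycles]

variable [Finite ι]

open Classical in
variable (D) in
/-- The cycles that do not meet the crossing `c`, paired with the same cycles in another state. -/
noncomputable def unaffectedPairs (c : ι) (s s' : State ι) : Finset (D.Cycle s × D.Cycle s') :=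
  Finset.univ.filter (D.Unaffected c s s')

theorem mem_unaffectedPairs {p : D.Cycle s × D.Cycle s'} :
    p ∈ D.unaffectedPairs c s s' ↔ D.Unaffected c s s' p := by
  simp [unaffectedPairs]

theorem image_fst_unaffectedPairs :
    (D.unaffectedPairs c s s').image Prod.fst = (D.siteCycles c s)ᶜ := by
  ext z
  simp only [Finset.mem_image, Finset.mem_compl, mem_unaffectedPairs]
  constructor
  · rintro ⟨p, hp, rfl⟩
    exact hp.fst_notMem_siteCycles
  · obtain ⟨q, rfl⟩ := D.cycleThrough_surjective s z
    intro hq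
    exact ⟨(_, D.cycleThrough s' q),
      unaffected_iff.2 ⟨q, cycleThrough_notMem_siteCycles.1 hq, rfl, rfl⟩, rfl⟩

namespace MonochromaticEdge

theorem unaffected_swap_iff (E : D.MonochromaticEdge χ c s s') {p : D.Cycle s × D.Cycle s'} :
    D.Unaffected c s' s p.swap ↔ D.Unaffected c s s' p := by
  simp only [unaffected_iff, E.avoids_iff, Prod.fst_swap, Prod.snd_swap, and_comm]

theorem fst_injOn_unaffectedPairs (E : D.MonochromaticEdge χ c s s') :
    Set.InjOn Prod.fst (D.unaffectedPairs c s s' : Set (D.Cycle s × D.Cycle s')) := by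
  intro p hp q hq h
  obtain ⟨a, ha, ha₁, ha₂⟩ := unaffected_iff.1 (mem_unaffectedPairs.1 hp)
  obtain ⟨b, -, hb₁, hb₂⟩ := unaffected_iff.1 (mem_unaffectedPairs.1 hq)
  refine Prod.ext h ?_
  rw [← ha₂, ← hb₂, E.cycleThrough_eq_iff_of_avoids ha, ha₁, hb₁, h]

variable {M : Type*} [CommMonoid M]

theorem prod_compl_siteCycles_left (E : D.MonochromaticEdge χ c s s') (f : D.Cycle s → M) :
    ∏ z ∈ (D.siteCycles c s)ᶜ, f z = ∏ p ∈ D.unaffectedPairs c s s', f p.1 := by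
  rw [← image_fst_unaffectedPairs (s' := s'), Finset.prod_image E.fst_injOn_unaffectedPairs]

theorem prod_compl_siteCycles_right (E : D.MonochromaticEdge χ c s s') (f : D.Cycle s' → M) :
    ∏ z ∈ (D.siteCycles c s')ᶜ, f z = ∏ p ∈ D.unaffectedPairs c s s', f p.2 := by
  rw [E.symm.prod_compl_siteCycles_left]
  exact Finset.prod_equiv (Equiv.prodComm _ _)
    (fun p => by simp [mem_unaffectedPairs, ← E.unaffected_swap_iff]) fun p _ => rfl

end MonochromaticEdge

end VirtualLinkDiagram

/-! ### The differential on colour vectors -/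

section Coefficients

variable (R : Type*) [CommRing R]

/-- The coefficients of the basis elements `1 = red + green` and `X = red - green` in the basis of
idempotents. -/
def Colour.dualCoeff : Colour → Label → R
  | .red, _ => 1
  | .green, .one => 1
  | .green, .X => -1

/-- The eigenvalue `2` or `-2` of the comultiplication: it sends the idempotent of the colour `k` to
this multiple of its tensor square. -/
def Colour.splitWeight : Colour → ℤ
  | .red => 2
  | .green => -2

theorem Label.sum_eq {M : Type*} [AddCommMonoid M] (f : Label → M) : ∑ a, f a = f .one + f .X := by
  rw [show (Finset.univ : Finset Label) = {.one, .X} by decide, Finset.sum_pair (by decide)]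

theorem Colour.sum_eq {M : Type*} [AddCommMonoid M] (f : Colour → M) :
    ∑ a, f a = f .red + f .green := by
  rw [show (Finset.univ : Finset Colour) = {.red, .green} by decide, Finset.sum_pair (by decide)]

variable [Invertible (2 : R)]

theorem Colour.coeff_mul_barSign (h k : Colour) (a : Label) :
    k.coeff R a * barSign R (h ≠ k) a = h.coeff R a := by
  cases h <;> cases k <;> cases a <;> simp [Colour.coeff, barSign]

theorem Colour.sum_coeff_mul_dualCoeff (h k : Colour) :
    ∑ a, h.coeff R a * k.dualCoeff R a = if h = k then 1 else 0 := by
  rw [Label.sum_eq]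
  cases h <;> cases k <;> simp [Colour.coeff, Colour.dualCoeff]

theorem Colour.sum_dualCoeff_mul_coeff (a b : Label) :
    ∑ k : Colour, k.coeff R a * k.dualCoeff R b = if a = b then 1 else 0 := by
  rw [Colour.sum_eq]
  cases a <;> cases b <;> simp [Colour.coeff, Colour.dualCoeff]

theorem mulCoeff_eq_sum (a b c : Label) :
    mulCoeff R a b c = ∑ k : Colour, k.dualCoeff R a * k.dualCoeff R b * k.coeff R c := by
  rw [Colour.sum_eq]
  cases a <;> cases b <;> cases c <;>
    simp [Colour.coeff, Colour.dualCoeff, mulCoeff, Label.mul]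

theorem comulCoeff_eq_sum (a b c : Label) :
    comulCoeff R a b c =
      ∑ k : Colour, (k.splitWeight : R) * (k.dualCoeff R a * (k.coeff R b * k.coeff R c)) := by
  rw [Colour.sum_eq]
  cases a <;> cases b <;> cases c <;>
    simp [Colour.coeff, Colour.dualCoeff, comulCoeff, Colour.splitWeight, ← mul_assoc]

theorem Colour.projCoeff_eq (k : Colour) (b a : Label) :
    k.projCoeff R b a = k.coeff R b * k.dualCoeff R a := by
  rw [Colour.projCoeff, Label.sum_eq]
  cases k <;> cases a <;> cases b <;> simp [Colour.coeff, Colour.dualCoeff, mulCoeff, Label.mul]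

namespace VirtualLinkDiagram.Compatible

variable {D : VirtualLinkDiagram ι} {s : State ι} {χ : HalfEdge ι → Colour} {h k : HalfEdge ι}

theorem coeff_mul_barSign (hχ : D.Compatible s χ) (hk : D.cycleOf s h = D.cycleOf s k) (a : Label) :
    (χ h).coeff R a * barSign R (D.Barred s h k) a = (χ k).coeff R a := by
  rw [hχ.barred_iff hk, ne_comm, Colour.coeff_mul_barSign]

theorem barSign_mul_coeff (hχ : D.Compatible s χ) (hk : D.cycleOf s h = D.cycleOf s k) (a : Label) :
    barSign R (D.Barred s h k) a * (χ k).coeff R a = (χ h).coeff R a := by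
  rw [hχ.barred_iff hk, mul_comm, Colour.coeff_mul_barSign]

end VirtualLinkDiagram.Compatible

end Coefficients

namespace VirtualLinkDiagram.GlobalData

variable {D : VirtualLinkDiagram ι}

section Finite

variable [Finite ι] (G : D.GlobalData)

/-- The marked point of a cycle; a component without crossings is its own marked point. -/
def mark (s : State ι) : D.Cycle s → D.Point := Sum.map (G.star s) id

@[simp] theorem mark_inl (s : State ι) (z : D.CrossingCycle s) :
    G.mark s (.inl z) = .inl (G.star s z) := rfl

@[simp] theorem mark_inr (s : State ι) (i : Fin D.circles) : G.mark s (.inr i) = .inr i := rfl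

theorem cycleThrough_mark (s : State ι) (z : D.Cycle s) : D.cycleThrough s (G.mark s z) = z := by
  rcases z with z | i
  · simp [G.cycleOf_star]
  · rfl

variable {c : ι} {s s' : State ι} {ψ : D.Point → Colour}

theorem starBarred_iff (E : D.MonochromaticEdge (ψ ∘ .inl) c s s') {p : D.Cycle s × D.Cycle s'}
    (hp : D.Unaffected c s s' p) :
    G.StarBarred s s' p ↔ ψ (G.mark s' p.2) ≠ ψ (G.mark s p.1) := by
  obtain ⟨q, hq, h₁, h₂⟩ := unaffected_iff.1 hp
  have hmark : D.cycleThrough s (G.mark s' p.2) = p.1 := by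
    rw [← h₁, eq_comm, ← E.cycleThrough_eq_iff_of_avoids hq, cycleThrough_mark, h₂]
  rcases p with ⟨z | i, z' | j⟩
  · simp only [mark_inl, cycleThrough_inl, Sum.inl.injEq] at hmark
    rw [StarBarred, E.compatible.barred_iff (by rw [hmark, G.cycleOf_star]), ne_comm]
    rfl
  · exact hp.elim
  · exact hp.elim
  · obtain rfl : i = j := hp
    simp [StarBarred]

variable (c s s' ψ) in
open Classical in
/-- The coefficient of the resmoothing of `c` on a coloured state with a single colour at `c`, apart
from the sign of the unaffected cycles. -/
noncomputable def localWeight : ℤ :=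
  if D.cycleOf s (D.site₁ c) ≠ D.cycleOf s (D.site₂ c) ∧
      D.cycleOf s' (D.site₁ c) = D.cycleOf s' (D.site₂ c) then
    G.sign₂ s (D.cycleOf s (D.site₁ c)) (D.cycleOf s (D.site₂ c)) *
      G.sign₁ s' (D.cycleOf s' (D.site₁ c))
  else if D.cycleOf s (D.site₁ c) = D.cycleOf s (D.site₂ c) ∧
      D.cycleOf s' (D.site₁ c) ≠ D.cycleOf s' (D.site₂ c) then
    G.sign₁ s (D.cycleOf s (D.site₁ c)) *
      G.sign₂ s' (D.cycleOf s' (D.site₁ c)) (D.cycleOf s' (D.site₂ c)) *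
      (ψ (.inl (D.site₁ c))).splitWeight
  else 0

variable (R : Type*) [CommRing R]

open Classical in
/-- The factor of `restCoeff` that involves the label `a` of the cycle `z`. -/
noncomputable def cycleCoeff (c : ι) (s s' : State ι) (l' : D.Cycle s' → Label) (z : D.Cycle s)
    (a : Label) : R :=
  ∏ z', if D.Unaffected c s s' (z, z') then
    (if a = l' z' then barSign R (G.StarBarred s s' (z, z')) a else 0) else 1

theorem restCoeff_eq_prod (l : D.Cycle s → Label) (l' : D.Cycle s' → Label) :
    G.restCoeff R c s s' l l' = ∏ z ∈ (D.siteCycles c s)ᶜ, G.cycleCoeff R c s s' l' z (l z) := by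
  rw [restCoeff, Fintype.prod_prod_type]
  refine (Finset.prod_subset (Finset.subset_univ _) fun z _ hz => ?_).symm
  refine Finset.prod_eq_one fun z' _ => if_neg fun h => ?_
  exact h.fst_notMem_siteCycles (Finset.notMem_compl.1 hz)

/-- The functional on labels that evaluates the coordinate of colour `k` after transport from the
marked point of the cycle through `h` to `h`. -/
noncomputable def siteCoord (s : State ι) (h : HalfEdge ι) (k : Colour) (a : Label) : R :=
  barSign R (D.Barred s h (G.star s (D.cycleOf s h))) a * k.dualCoeff R a

variable [Invertible (2 : R)]

theorem sum_siteCoord_mul_coeff (hχ : D.Compatible s (ψ ∘ .inl)) (h : HalfEdge ι) (k : Colour) :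
    ∑ a, G.siteCoord R s h k a * (ψ (G.mark s (.inl (D.cycleOf s h)))).coeff R a =
      if ψ (.inl h) = k then 1 else 0 := by
  rw [← Colour.sum_coeff_mul_dualCoeff R]
  refine Finset.sum_congr rfl fun a _ => ?_
  rw [siteCoord, mul_right_comm]
  exact congrArg (· * _) (hχ.barSign_mul_coeff R (G.cycleOf_star _ _).symm a)

theorem coeff_mul_siteSign (hχ : D.Compatible s (ψ ∘ .inl)) (l : D.Cycle s → Label)
    (h : HalfEdge ι) :
    (ψ (.inl h)).coeff R (l (.inl (D.cycleOf s h))) * G.siteSign R s l h =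
      (ψ (G.mark s (.inl (D.cycleOf s h)))).coeff R (l (.inl (D.cycleOf s h))) :=
  hχ.coeff_mul_barSign R (G.cycleOf_star _ _).symm _

theorem sum_cycleCoeff (E : D.MonochromaticEdge (ψ ∘ .inl) c s s') (l' : D.Cycle s' → Label)
    {p : D.Cycle s × D.Cycle s'} (hp : p ∈ D.unaffectedPairs c s s') :
    ∑ a, G.cycleCoeff R c s s' l' p.1 a * (ψ (G.mark s p.1)).coeff R a =
      (ψ (G.mark s' p.2)).coeff R (l' p.2) := by
  have hp' := mem_unaffectedPairs.1 hp
  have hcoeff (a) : G.cycleCoeff R c s s' l' p.1 a =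
      if a = l' p.2 then barSign R (G.StarBarred s s' p) a else 0 := by
    rw [cycleCoeff, Finset.prod_eq_single p.2, if_pos hp']
    · refine fun z' _ hz' => if_neg fun h => hz' ?_
      exact congrArg Prod.snd (E.fst_injOn_unaffectedPairs (mem_unaffectedPairs.2 h) hp rfl)
    · simp
  simp only [hcoeff, ite_mul, zero_mul, Finset.sum_ite_eq', Finset.mem_univ, if_true]
  rw [G.starBarred_iff E hp', mul_comm, Colour.coeff_mul_barSign]

theorem sum_restCoeff_mul_prod (κ : D.Cycle s → Colour) (l' : D.Cycle s' → Label)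
    (w : D.Cycle s → Label → R) :
    ∑ l : D.Cycle s → Label, G.restCoeff R c s s' l l' * (∏ z ∈ D.siteCycles c s, w z (l z)) *
        ∏ z, (κ z).coeff R (l z) =
      (∏ z ∈ D.siteCycles c s, ∑ a, w z a * (κ z).coeff R a) *
        ∏ z ∈ (D.siteCycles c s)ᶜ, ∑ a, G.cycleCoeff R c s s' l' z a * (κ z).coeff R a := by
  let F (z : D.Cycle s) (a : Label) : R :=
    (if z ∈ D.siteCycles c s then w z a else G.cycleCoeff R c s s' l' z a) * (κ z).coeff R a
  have hF (l : D.Cycle s → Label) : G.restCoeff R c s s' l l' *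
      (∏ z ∈ D.siteCycles c s, w z (l z)) * ∏ z, (κ z).coeff R (l z) = ∏ z, F z (l z) := by
    rw [Finset.prod_mul_distrib, Finset.prod_ite, Finset.filter_mem_eq_inter, Finset.univ_inter,
      Finset.filter_notMem_eq_sdiff, ← Finset.compl_eq_univ_sdiff, restCoeff_eq_prod]
    ring
  simp only [hF]
  rw [← Fintype.piFinset_univ, ← Finset.prod_univ_sum,
    ← Finset.prod_mul_prod_compl (D.siteCycles c s)]
  congr 1
  · exact Finset.prod_congr rfl fun z hz => by simp only [F, if_pos hz]
  · exact Finset.prod_congr rfl fun z hz => by simp only [F, if_neg (Finset.mem_compl.1 hz)]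

theorem prod_sum_cycleCoeff (E : D.MonochromaticEdge (ψ ∘ .inl) c s s')
    (l' : D.Cycle s' → Label) :
    ∏ z ∈ (D.siteCycles c s)ᶜ, ∑ a, G.cycleCoeff R c s s' l' z a * (ψ (G.mark s z)).coeff R a =
      ∏ z ∈ (D.siteCycles c s')ᶜ, (ψ (G.mark s' z)).coeff R (l' z) := by
  rw [E.prod_compl_siteCycles_left, E.prod_compl_siteCycles_right]
  exact Finset.prod_congr rfl fun p hp => G.sum_cycleCoeff R E l' hp

theorem sum_merge (hχ : D.Compatible s (ψ ∘ .inl)) (hs : ∀ d, d ≠ c → s' d = s d)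
    (hne : s c ≠ s' c) (hm : D.cycleOf s (D.site₁ c) ≠ D.cycleOf s (D.site₂ c))
    (hm' : D.cycleOf s' (D.site₁ c) = D.cycleOf s' (D.site₂ c)) (l' : D.Cycle s' → Label) :
    ∑ l : D.Cycle s → Label, G.restCoeff R c s s' l l' *
        (G.siteSign R s l (D.site₁ c) * G.siteSign R s l (D.site₂ c) *
          mulCoeff R (l (.inl (D.cycleOf s (D.site₁ c)))) (l (.inl (D.cycleOf s (D.site₂ c))))
            (l' (.inl (D.cycleOf s' (D.site₁ c)))) *
          G.siteSign R s' l' (D.site₁ c)) * ∏ z, (ψ (G.mark s z)).coeff R (l z) =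
      if ψ (.inl (D.site₁ c)) = ψ (.inl (D.site₂ c)) then
        ∏ z, (ψ (G.mark s' z)).coeff R (l' z) else 0 := by
  set x := D.site₁ c
  set y := D.site₂ c
  have hxy : Sum.inl (D.cycleOf s x) ≠ (Sum.inl (D.cycleOf s y) : D.Cycle s) := by simpa using hm
  let w (k : Colour) (z : D.Cycle s) : Label → R :=
    if z = .inl (D.cycleOf s x) then G.siteCoord R s x k else G.siteCoord R s y k
  have hw (k : Colour) (l : D.Cycle s → Label) : ∏ z ∈ D.siteCycles c s, w k z (l z) =
      G.siteCoord R s x k (l (.inl (D.cycleOf s x))) *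
        G.siteCoord R s y k (l (.inl (D.cycleOf s y))) := by
    rw [siteCycles, Finset.prod_pair hxy]
    simp only [w, if_true, if_neg hxy.symm]
  have hsum (k : Colour) : ∏ z ∈ D.siteCycles c s, ∑ a, w k z a * (ψ (G.mark s z)).coeff R a =
      (if ψ (.inl x) = k then 1 else 0) * if ψ (.inl y) = k then 1 else 0 := by
    rw [siteCycles, Finset.prod_pair hxy]
    simp only [w, if_true, if_neg hxy.symm, G.sum_siteCoord_mul_coeff R hχ]
  trans ∑ k : Colour, k.coeff R (l' (.inl (D.cycleOf s' x))) * G.siteSign R s' l' x *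
      ∑ l : D.Cycle s → Label, G.restCoeff R c s s' l l' *
        (∏ z ∈ D.siteCycles c s, w k z (l z)) * ∏ z, (ψ (G.mark s z)).coeff R (l z)
  · simp only [Finset.mul_sum]
    rw [Finset.sum_comm]
    refine Finset.sum_congr rfl fun l _ => ?_
    simp only [hw, mulCoeff_eq_sum, Finset.mul_sum, Finset.sum_mul, siteCoord, siteSign]
    exact Finset.sum_congr rfl fun k _ => by ring
  simp only [G.sum_restCoeff_mul_prod R fun z => ψ (G.mark s z), hsum]
  rw [Finset.sum_eq_single (ψ (.inl x)) (fun k _ hk => by simp [hk.symm]) (by simp)]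
  by_cases hmono : ψ (.inl x) = ψ (.inl y)
  · have E : D.MonochromaticEdge (ψ ∘ .inl) c s s' := ⟨hχ, hmono, hs, hne⟩
    rw [if_pos rfl, if_pos hmono.symm, if_pos hmono, one_mul, one_mul,
      G.coeff_mul_siteSign R E.symm.compatible, G.prod_sum_cycleCoeff R E,
      ← Finset.prod_mul_prod_compl (D.siteCycles c s') fun z => (ψ (G.mark s' z)).coeff R (l' z)]
    rw [siteCycles, ← hm', Finset.pair_eq_singleton, Finset.prod_singleton]
  · simp [hmono, Ne.symm hmono]

theorem sum_split (hχ : D.Compatible s (ψ ∘ .inl)) (hs : ∀ d, d ≠ c → s' d = s d)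
    (hne : s c ≠ s' c) (hm : D.cycleOf s (D.site₁ c) = D.cycleOf s (D.site₂ c))
    (hm' : D.cycleOf s' (D.site₁ c) ≠ D.cycleOf s' (D.site₂ c)) (l' : D.Cycle s' → Label) :
    ∑ l : D.Cycle s → Label, G.restCoeff R c s s' l l' *
        (G.siteSign R s l (D.site₁ c) *
          comulCoeff R (l (.inl (D.cycleOf s (D.site₁ c))))
            (l' (.inl (D.cycleOf s' (D.site₁ c)))) (l' (.inl (D.cycleOf s' (D.site₂ c)))) *
          (G.siteSign R s' l' (D.site₁ c) * G.siteSign R s' l' (D.site₂ c))) *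
        ∏ z, (ψ (G.mark s z)).coeff R (l z) =
      ((ψ (.inl (D.site₁ c))).splitWeight : R) * ∏ z, (ψ (G.mark s' z)).coeff R (l' z) := by
  have E : D.MonochromaticEdge (ψ ∘ .inl) c s s' := ⟨hχ, hχ.mono_of_split hs hne hm hm', hs, hne⟩
  have hmono : ψ (.inl (D.site₁ c)) = ψ (.inl (D.site₂ c)) := E.mono
  set x := D.site₁ c
  set y := D.site₂ c
  have hsites : D.siteCycles c s = {.inl (D.cycleOf s x)} := by
    rw [siteCycles, ← hm, Finset.pair_eq_singleton]
  trans ∑ k : Colour, (k.splitWeight : R) *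
      ((k.coeff R (l' (.inl (D.cycleOf s' x))) * G.siteSign R s' l' x) *
        (k.coeff R (l' (.inl (D.cycleOf s' y))) * G.siteSign R s' l' y)) *
      ∑ l : D.Cycle s → Label, G.restCoeff R c s s' l l' *
        (∏ z ∈ D.siteCycles c s, G.siteCoord R s x k (l z)) * ∏ z, (ψ (G.mark s z)).coeff R (l z)
  · simp only [Finset.mul_sum]
    rw [Finset.sum_comm]
    refine Finset.sum_congr rfl fun l _ => ?_
    simp only [hsites, Finset.prod_singleton, comulCoeff_eq_sum, Finset.mul_sum, Finset.sum_mul,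
      siteCoord, siteSign]
    exact Finset.sum_congr rfl fun k _ => by ring
  have hsum (k : Colour) : ∏ z ∈ D.siteCycles c s,
      ∑ a, G.siteCoord R s x k a * (ψ (G.mark s z)).coeff R a =
        if ψ (.inl x) = k then 1 else 0 := by
    rw [hsites, Finset.prod_singleton, G.sum_siteCoord_mul_coeff R hχ]
  simp only [G.sum_restCoeff_mul_prod R fun z => ψ (G.mark s z), hsum, ite_mul, one_mul, zero_mul,
    mul_ite, mul_zero, Finset.sum_ite_eq, Finset.mem_univ, if_true]
  rw [G.coeff_mul_siteSign R E.symm.compatible, hmono, G.coeff_mul_siteSign R E.symm.compatible,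
    G.prod_sum_cycleCoeff R E, mul_assoc,
    ← Finset.prod_mul_prod_compl (D.siteCycles c s') fun z => (ψ (G.mark s' z)).coeff R (l' z)]
  rw [siteCycles, Finset.prod_pair (by simpa using hm')]

theorem sum_localCoeff (hχ : D.Compatible s (ψ ∘ .inl)) (hs : ∀ d, d ≠ c → s' d = s d)
    (hne : s c ≠ s' c) (l' : D.Cycle s' → Label) :
    ∑ l : D.Cycle s → Label, G.restCoeff R c s s' l l' * G.localCoeff R c s s' l l' *
        ∏ z, (ψ (G.mark s z)).coeff R (l z) =
      if ψ (.inl (D.site₁ c)) = ψ (.inl (D.site₂ c)) then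
        (G.localWeight c s s' ψ : R) * ∏ z, (ψ (G.mark s' z)).coeff R (l' z) else 0 := by
  classical
  by_cases h₁ : D.cycleOf s (D.site₁ c) ≠ D.cycleOf s (D.site₂ c) ∧
      D.cycleOf s' (D.site₁ c) = D.cycleOf s' (D.site₂ c)
  · simp only [localCoeff, localWeight, if_pos h₁]
    simp only [mul_left_comm _ (Int.cast _ : R), mul_assoc (Int.cast _ : R), ← Finset.mul_sum]
    rw [G.sum_merge R hχ hs hne h₁.1 h₁.2, mul_ite, mul_zero]
  by_cases h₂ : D.cycleOf s (D.site₁ c) = D.cycleOf s (D.site₂ c) ∧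
      D.cycleOf s' (D.site₁ c) ≠ D.cycleOf s' (D.site₂ c)
  · have hmono : ψ (.inl (D.site₁ c)) = ψ (.inl (D.site₂ c)) :=
      hχ.mono_of_split hs hne h₂.1 h₂.2
    simp only [localCoeff, localWeight, if_neg h₁, if_pos h₂, if_pos hmono]
    simp only [mul_left_comm _ (Int.cast _ : R), mul_assoc (Int.cast _ : R), ← Finset.mul_sum]
    rw [G.sum_split R hχ hs hne h₂.1 h₂.2, Int.cast_mul (_ * _), mul_assoc]
  · simp [localCoeff, localWeight, if_neg h₁, if_neg h₂]

end Finite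

section Differential

variable [Fintype ι] [DecidableEq ι] (G : D.GlobalData)

/-- The coefficient of the resmoothing of `c` on a coloured state with a single colour at `c`. -/
noncomputable def edgeWeight (c : ι) (s : State ι) (ψ : D.Point → Colour) : ℤ :=
  G.restSign c s (Function.update s c true) * G.localWeight c s (Function.update s c true) ψ

variable (R : Type*) [CommRing R] [Invertible (2 : R)]

/-- The tensor product of the idempotents given by the colours of the cycles of the state `s` at
their marked points. -/
noncomputable def colourVector (s : State ι) (ψ : D.Point → Colour) : D.EnhancedState → R :=
  fun x => if x.1 = s then ∏ z, (ψ (G.mark x.1 z)).coeff R (x.2 z) else 0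

theorem differential_mulVec_colourVector {s : State ι} {ψ : D.Point → Colour}
    (hχ : D.Compatible s (ψ ∘ .inl)) :
    (G.differential R).mulVec (G.colourVector R s ψ) =
      ∑ c, if s c = false ∧ ψ (.inl (D.site₁ c)) = ψ (.inl (D.site₂ c)) then
        (G.edgeWeight c s ψ : R) • G.colourVector R (Function.update s c true) ψ else 0 := by
  ext ⟨s', l'⟩
  rw [Matrix.mulVec, dotProduct, Fintype.sum_sigma, Finset.sum_eq_single s]
  · simp only [differential, colourVector, if_true, Finset.sum_mul, Finset.sum_apply]
    rw [Finset.sum_comm]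
    refine Finset.sum_congr rfl fun c _ => ?_
    by_cases hc : s c = false
    · by_cases hs' : s' = Function.update s c true
      · subst hs'
        simp only [hc, true_and, if_true, mul_assoc (Int.cast _ : R), ← Finset.mul_sum]
        rw [G.sum_localCoeff R hχ (fun d hd => Function.update_of_ne hd _ _) (by simp [hc])]
        split_ifs <;> simp [colourVector, edgeWeight, mul_assoc]
      · simp only [hc, hs', and_false, if_false, zero_mul, Finset.sum_const_zero, true_and]
        split_ifs <;> simp [colourVector, hs']
    · simp [hc]
  · intro t _ ht
    refine Finset.sum_eq_zero fun l _ => ?_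
    rw [colourVector, if_neg ht, mul_zero]
  · simp

end Differential

end VirtualLinkDiagram.GlobalData

/-! ### The volume form of an order of the cycles -/

section ListSign

variable {P : Type*} {o o' : P → ℕ}

/-- The sign that tells whether `a` comes before `b` in the order given by the positions `o`; it is
zero if the positions agree. -/
def orderSign (o : P → ℕ) (a b : P) : ℤ := if o a < o b then 1 else if o b < o a then -1 else 0

/-- The sign of the permutation that sorts a list by the positions `o`, or zero if some position
occurs twice. -/
def listSign (o : P → ℕ) : List P → ℤ
  | [] => 1
  | a :: l => (l.map (orderSign o a)).prod * listSign o l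

theorem orderSign_comm (a b : P) : orderSign o b a = -orderSign o a b := by
  unfold orderSign
  split_ifs <;> omega

theorem orderSign_congr {a b : P} (h : o a = o b) : orderSign o a = orderSign o b := by
  funext c
  simp only [orderSign, h]

theorem orderSign_mul_self {a b : P} (h : o a ≠ o b) : orderSign o a b * orderSign o a b = 1 := by
  unfold orderSign
  split_ifs <;> omega

theorem listSign_cons_congr {a b : P} (h : o a = o b) (l : List P) :
    listSign o (a :: l) = listSign o (b :: l) := by
  simp only [listSign, orderSign_congr h]

theorem listSign_swap (a b : P) (l : List P) :
    listSign o (a :: b :: l) = -listSign o (b :: a :: l) := by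
  simp only [listSign, List.map_cons, List.prod_cons, orderSign_comm a b]
  ring

theorem listSign_append_cons (a : P) (l₁ l₂ : List P) :
    listSign o (l₁ ++ a :: l₂) = (-1) ^ l₁.length * listSign o (a :: (l₁ ++ l₂)) := by
  induction l₁ with
  | nil => simp
  | cons b l₁ ih =>
    rw [List.cons_append, List.cons_append, List.length_cons, listSign_swap a b, listSign, ih]
    simp only [listSign, List.map_append, List.map_cons, List.prod_append, List.prod_cons]
    ring

theorem listSign_eq_zero {l : List P} (h : ¬ (l.map o).Nodup) : listSign o l = 0 := by
  induction l with
  | nil => simp at h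
  | cons a l ih =>
    rw [List.map_cons, List.nodup_cons, not_and_or, not_not, List.mem_map] at h
    rw [listSign, mul_eq_zero]
    refine h.imp ?_ ih
    rintro ⟨b, hb, hba⟩
    exact List.prod_eq_zero (List.mem_map.2 ⟨b, hb, by simp [orderSign, hba]⟩)

theorem listSign_mul_self {l : List P} (h : (l.map o).Nodup) : listSign o l * listSign o l = 1 := by
  induction l with
  | nil => simp [listSign]
  | cons a l ih =>
    rw [List.map_cons, List.nodup_cons] at h
    have hprod : (l.map (orderSign o a)).prod * (l.map (orderSign o a)).prod = 1 := by
      rw [← List.prod_map_mul]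
      refine List.prod_eq_one fun x hx => ?_
      obtain ⟨b, hb, rfl⟩ := List.mem_map.1 hx
      exact orderSign_mul_self fun e => h.1 (List.mem_map.2 ⟨b, hb, e.symm⟩)
    rw [listSign, mul_mul_mul_comm, hprod, ih h.2, one_mul]

theorem prod_inversions_eq {l : List P} (h : (l.map o).Nodup) (h' : (l.map o').Nodup) :
    (l.map fun a => (l.map fun b => if o a < o b ∧ o' b < o' a then (-1 : ℤ) else 1).prod).prod =
      listSign o l * listSign o' l := by
  induction l with
  | nil => simp [listSign]
  | cons a l ih =>
    rw [List.map_cons, List.nodup_cons] at h h'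
    have hpair : (l.map fun b => (if o a < o b ∧ o' b < o' a then (-1 : ℤ) else 1) *
        if o b < o a ∧ o' a < o' b then (-1 : ℤ) else 1) =
        l.map fun b => orderSign o a b * orderSign o' a b := by
      refine List.map_congr_left fun b hb => ?_
      have hne : o a ≠ o b := fun e => h.1 (List.mem_map.2 ⟨b, hb, e.symm⟩)
      have hne' : o' a ≠ o' b := fun e => h'.1 (List.mem_map.2 ⟨b, hb, e.symm⟩)
      unfold orderSign
      split_ifs <;> omega
    simp only [List.map_cons, List.prod_cons, lt_irrefl, false_and, if_false, one_mul, listSign,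
      List.prod_map_mul]
    rw [ih h.2 h'.2, ← mul_assoc, ← List.prod_map_mul, hpair, List.prod_map_mul]
    ring

end ListSign

namespace VirtualLinkDiagram

variable {D : VirtualLinkDiagram ι} [Finite ι] {χ : HalfEdge ι → Colour} {c : ι} {s s' : State ι}
  {l r : List D.Point}

variable (D) in
/-- The points of the list `l` lie one on each cycle of the state `s`. -/
structure IsTransversal (s : State ι) (l : List D.Point) : Prop where
  nodup : (l.map (D.cycleThrough s)).Nodup
  length_eq : l.length = Fintype.card (D.Cycle s)

namespace IsTransversal

theorem exists_mem (h : D.IsTransversal s l) (z : D.Cycle s) :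
    ∃ p ∈ l, D.cycleThrough s p = z := by
  have huniv : (l.map (D.cycleThrough s)).toFinset = Finset.univ := by
    rw [← Finset.card_eq_iff_eq_univ, List.toFinset_card_of_nodup h.nodup, List.length_map,
      h.length_eq]
  rw [← List.mem_map, ← List.mem_toFinset, huniv]
  exact Finset.mem_univ z

theorem perm {l' : List D.Point} (h : D.IsTransversal s l) (hl : l.Perm l') :
    D.IsTransversal s l' :=
  ⟨(hl.map _).nodup_iff.1 h.nodup, hl.length_eq ▸ h.length_eq⟩

theorem cons_congr {a b : D.Point} (h : D.IsTransversal s (a :: l))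
    (hab : D.cycleThrough s a = D.cycleThrough s b) : D.IsTransversal s (b :: l) :=
  ⟨by simpa only [List.map_cons, hab] using h.nodup, h.length_eq⟩

theorem ne_of_mem {a p : D.Point} (h : D.IsTransversal s (a :: l)) (hp : p ∈ l) :
    D.cycleThrough s p ≠ D.cycleThrough s a :=
  fun e => (List.nodup_cons.1 h.nodup).1 (List.mem_map.2 ⟨p, hp, e⟩)

end IsTransversal

namespace MonochromaticEdge

theorem card_cycle_of_merge (E : D.MonochromaticEdge χ c s s')
    (hm : D.cycleOf s (D.site₁ c) ≠ D.cycleOf s (D.site₂ c)) :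
    Fintype.card (D.Cycle s) = Fintype.card (D.Cycle s') + 1 := by
  have hcompl : (D.siteCycles c s)ᶜ.card = (D.siteCycles c s')ᶜ.card := by
    have hpow := (E.prod_compl_siteCycles_left fun _ => 2).trans
      (E.prod_compl_siteCycles_right fun _ => 2).symm
    exact Nat.pow_right_injective le_rfl (by simpa only [Finset.prod_const] using hpow)
  have hcard : (D.siteCycles c s).card = 2 := Finset.card_pair (by simpa using hm)
  have hcard' : (D.siteCycles c s').card = 1 := by
    simp [siteCycles, E.cycleOf_site_eq_iff.2 hm]
  have hsum := (D.siteCycles c s).card_add_card_compl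
  have hsum' := (D.siteCycles c s').card_add_card_compl
  omega

theorem isTransversal_of_cons (E : D.MonochromaticEdge χ c s s')
    (hm : D.cycleOf s (D.site₁ c) ≠ D.cycleOf s (D.site₂ c)) {z : D.Point}
    (hz : ¬ D.Avoids c s z) (h : D.IsTransversal s (z :: l)) : D.IsTransversal s' l := by
  refine ⟨?_, by simpa [E.card_cycle_of_merge hm] using h.length_eq⟩
  have hl := (List.nodup_cons.1 h.nodup).2
  rw [List.Nodup, List.pairwise_map] at hl ⊢
  refine hl.imp_of_mem fun {a b} ha hb hab heq => ?_
  have haz := h.ne_of_mem ha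
  have hbz := h.ne_of_mem hb
  rcases (E.cycleThrough_eq_iff_of_merge hm).1 heq with heq | ⟨ha', hb'⟩
  · exact hab heq
  · simp only [Avoids, not_and_or, not_not, ne_eq] at hz ha' hb'
    grind

theorem avoids_of_isTransversal (E : D.MonochromaticEdge χ c s s')
    (hm : D.cycleOf s (D.site₁ c) ≠ D.cycleOf s (D.site₂ c))
    (h : D.IsTransversal s' (.inl (D.site₁ c) :: r)) {p : D.Point} (hp : p ∈ r) :
    D.Avoids c s p := by
  have hne := h.ne_of_mem hp
  have hm' := E.cycleOf_site_eq_iff.2 hm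
  exact E.avoids_iff.1 ⟨hne, hm' ▸ hne⟩

theorem isTransversal_sites (E : D.MonochromaticEdge χ c s s')
    (hm : D.cycleOf s (D.site₁ c) ≠ D.cycleOf s (D.site₂ c))
    (h : D.IsTransversal s' (.inl (D.site₁ c) :: r)) :
    D.IsTransversal s (.inl (D.site₁ c) :: .inl (D.site₂ c) :: r) := by
  have hav {p : D.Point} (hp : p ∈ r) := E.avoids_of_isTransversal hm h hp
  have hr : (r.map (D.cycleThrough s)).Nodup := by
    have hr' := (List.nodup_cons.1 h.nodup).2
    rw [List.Nodup, List.pairwise_map] at hr' ⊢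
    exact hr'.imp_of_mem fun ha _ => mt (E.cycleThrough_eq_iff_of_avoids (hav ha)).2
  constructor
  · simp only [List.map_cons, List.nodup_cons, List.mem_cons, List.mem_map, not_or]
    exact ⟨⟨by simpa using hm, fun ⟨p, hp, e⟩ => (hav hp).1 e⟩,
      fun ⟨p, hp, e⟩ => (hav hp).2 e, hr⟩
  · rw [E.card_cycle_of_merge hm, ← h.length_eq, List.length_cons, List.length_cons,
      List.length_cons]

end MonochromaticEdge

namespace GlobalData

variable (G : D.GlobalData)

/-- The position of the cycle through a point in the order of the cycles of the state `s`. -/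
noncomputable def position (s : State ι) (p : D.Point) : ℕ := G.order s (D.cycleThrough s p)

theorem position_eq_iff {p q : D.Point} :
    G.position s p = G.position s q ↔ D.cycleThrough s p = D.cycleThrough s q := by
  rw [position, position, Fin.val_inj, (G.order s).injective.eq_iff]

theorem nodup_position_iff :
    (l.map (G.position s)).Nodup ↔ (l.map (D.cycleThrough s)).Nodup := by
  have hcomp : l.map (G.position s) =
      (l.map (D.cycleThrough s)).map fun z => (G.order s z : ℕ) := by
    rw [List.map_map]
    rfl
  rw [hcomp, List.nodup_map_iff]
  exact fun z w h => (G.order s).injective (Fin.val_injective h)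

theorem prod_orderSign {a : D.Point} (h : D.IsTransversal s (a :: r)) :
    (r.map (orderSign (G.position s) a)).prod = (-1) ^ G.position s a := by
  have hsign : r.map (orderSign (G.position s) a) = (r.map (D.cycleThrough s)).map fun z =>
      if G.order s z < G.order s (D.cycleThrough s a) then (-1 : ℤ) else 1 := by
    rw [List.map_map]
    refine List.map_congr_left fun b hb => ?_
    have hne := mt G.position_eq_iff.1 (h.ne_of_mem hb)
    simp only [orderSign, Function.comp, Fin.lt_def]
    unfold position at *
    split_ifs <;> omega
  have hr : (r.map (D.cycleThrough s)).toFinset = Finset.univ.erase (D.cycleThrough s a) := by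
    ext z
    simp only [List.mem_toFinset, List.mem_map, Finset.mem_erase, Finset.mem_univ, and_true]
    refine ⟨fun ⟨p, hp, e⟩ => e ▸ h.ne_of_mem hp, fun hz => ?_⟩
    obtain ⟨p, hp, rfl⟩ := h.exists_mem z
    exact ⟨p, (List.mem_cons.1 hp).resolve_left fun e => hz (e ▸ rfl), rfl⟩
  have hbelow : (Finset.univ.filter fun z => G.order s z < G.order s (D.cycleThrough s a)) =
      (Finset.Iio (G.order s (D.cycleThrough s a))).map (G.order s).symm.toEmbedding := by
    ext z
    simp
  rw [hsign, ← List.prod_toFinset _ (List.nodup_cons.1 h.nodup).2, hr,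
    Finset.prod_erase _ (by simp), Finset.prod_ite, Finset.prod_const_one, mul_one,
    Finset.prod_const, hbelow, Finset.card_map, Fin.card_Iio, position]

theorem sign₁_eq {h : HalfEdge ι} (hr : D.IsTransversal s (.inl h :: r)) :
    G.sign₁ s (D.cycleOf s h) = (r.map (orderSign (G.position s) (.inl h))).prod :=
  (G.prod_orderSign hr).symm

theorem sign₂_eq {h k : HalfEdge ι} (hr : D.IsTransversal s (.inl h :: .inl k :: r)) :
    G.sign₂ s (D.cycleOf s h) (D.cycleOf s k) =
      orderSign (G.position s) (.inl h) (.inl k) *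
        ((r.map (orderSign (G.position s) (.inl h))).prod *
          (r.map (orderSign (G.position s) (.inl k))).prod) := by
  have hh := G.prod_orderSign hr
  have hk := G.prod_orderSign (hr.perm (.swap ..))
  have hne : G.position s (.inl k) ≠ G.position s (.inl h) :=
    mt G.position_eq_iff.1 (hr.ne_of_mem List.mem_cons_self)
  rw [List.map_cons, List.prod_cons] at hh hk
  rw [orderSign_comm] at hk
  have hsign : G.sign₂ s (D.cycleOf s h) (D.cycleOf s k) =
      -orderSign (G.position s) (.inl h) (.inl k) *
        ((-1) ^ G.position s (.inl h) * (-1) ^ G.position s (.inl k)) := by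
    rw [← pow_add, sign₂]
    rcases lt_or_gt_of_ne hne with hlt | hlt
    · rw [if_neg (by exact hlt.not_gt), orderSign, if_neg hlt.not_gt, if_pos hlt, neg_neg, one_mul]
      rfl
    · rw [if_pos (by exact hlt), orderSign, if_pos hlt, pow_succ, mul_comm]
      rfl
  rw [hsign, ← hh, ← hk]
  linear_combination (orderSign (G.position s) (.inl h) (.inl k) *
    ((r.map (orderSign (G.position s) (.inl h))).prod *
      (r.map (orderSign (G.position s) (.inl k))).prod)) * orderSign_mul_self hne.symm

theorem restSign_symm (E : D.MonochromaticEdge χ c s s') :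
    G.restSign c s' s = G.restSign c s s' := by
  unfold restSign
  congr 1
  refine Finset.card_equiv
    ((Equiv.prodComm _ _).trans (Equiv.prodCongr (Equiv.prodComm _ _) (Equiv.prodComm _ _)))
    fun p => ?_
  simp only [Finset.mem_filter, Finset.mem_univ, true_and, Equiv.trans_apply,
    Equiv.prodComm_apply, Equiv.prodCongr_apply, Prod.map, Prod.fst_swap, Prod.snd_swap,
    E.symm.unaffected_swap_iff]
  tauto

theorem restSign_eq_prod (c : ι) (s s' : State ι) :
    G.restSign c s s' = ∏ p ∈ D.unaffectedPairs c s s', ∏ q ∈ D.unaffectedPairs c s s',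
      if G.order s p.1 < G.order s q.1 ∧ G.order s' q.2 < G.order s' p.2 then (-1 : ℤ) else 1 := by
  rw [← Finset.prod_product', Finset.prod_ite, Finset.prod_const_one, mul_one, Finset.prod_const,
    restSign]
  congr 2
  ext p
  simp only [Finset.mem_filter, Finset.mem_univ, true_and, Finset.mem_product,
    mem_unaffectedPairs, and_assoc]

theorem restSign_eq (E : D.MonochromaticEdge χ c s s')
    (hm : D.cycleOf s (D.site₁ c) ≠ D.cycleOf s (D.site₂ c))
    (h : D.IsTransversal s' (.inl (D.site₁ c) :: r)) :
    G.restSign c s s' = listSign (G.position s) r * listSign (G.position s') r := by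
  classical
  have hav {p : D.Point} (hp : p ∈ r) := E.avoids_of_isTransversal hm h hp
  have hr' := (List.nodup_cons.1 h.nodup).2
  have hr := (List.nodup_cons.1 (List.nodup_cons.1 (E.isTransversal_sites hm h).nodup).2).2
  have hpairs : D.unaffectedPairs c s s' =
      (r.map fun p => (D.cycleThrough s p, D.cycleThrough s' p)).toFinset := by
    ext p
    rw [mem_unaffectedPairs, unaffected_iff, List.mem_toFinset, List.mem_map]
    constructor
    · rintro ⟨q, hq, hq₁, hq₂⟩
      obtain ⟨a, ha, haq⟩ := h.exists_mem (D.cycleThrough s' q)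
      have har : a ∈ r := (List.mem_cons.1 ha).resolve_left
        fun e => (E.avoids_iff.2 hq).1 (by rw [← haq, e, cycleThrough_inl])
      rw [E.cycleThrough_eq_iff_of_avoids (hav har)] at haq
      exact ⟨a, har, Prod.ext (haq.trans hq₁)
        (((E.cycleThrough_eq_iff_of_avoids (hav har)).2 haq).trans hq₂)⟩
    · rintro ⟨a, ha, rfl⟩
      exact ⟨a, hav ha, rfl, rfl⟩
  have hnodup : (r.map fun p => (D.cycleThrough s p, D.cycleThrough s' p)).Nodup :=
    .of_map Prod.fst (by rwa [List.map_map])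
  rw [restSign_eq_prod, hpairs, List.prod_toFinset _ hnodup, List.map_map, ← prod_inversions_eq
    (G.nodup_position_iff.2 hr) (G.nodup_position_iff.2 hr')]
  congr 1
  refine List.map_congr_left fun a _ => ?_
  simp only [Function.comp]
  rw [List.prod_toFinset _ hnodup, List.map_map]
  rfl

/-- The sign of the partial differential from the state `s` to the state `s'` if it merges two
cycles; for a split it is the sign of the reverse merge. -/
noncomputable def mergeSign (c : ι) (s s' : State ι) : ℤ :=
  G.restSign c s s' * (G.sign₂ s (D.cycleOf s (D.site₁ c)) (D.cycleOf s (D.site₂ c)) *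
    G.sign₁ s' (D.cycleOf s' (D.site₁ c)))

theorem isUnit_restSign (c : ι) (s s' : State ι) : IsUnit (G.restSign c s s') :=
  isUnit_one.neg.pow _

theorem isUnit_sign₁ (s : State ι) (z : D.CrossingCycle s) : IsUnit (G.sign₁ s z) :=
  isUnit_one.neg.pow _

theorem isUnit_sign₂ (s : State ι) (z w : D.CrossingCycle s) : IsUnit (G.sign₂ s z w) := by
  rw [sign₂]
  split_ifs <;> exact isUnit_one.neg.pow _

theorem mergeSign_mul_self (c : ι) (s s' : State ι) :
    G.mergeSign c s s' * G.mergeSign c s s' = 1 :=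
  Int.isUnit_mul_self
    ((G.isUnit_restSign c s s').mul ((G.isUnit_sign₂ s _ _).mul (G.isUnit_sign₁ s' _)))

theorem mergeSign_eq (E : D.MonochromaticEdge χ c s s')
    (hm : D.cycleOf s (D.site₁ c) ≠ D.cycleOf s (D.site₂ c))
    (h : D.IsTransversal s' (.inl (D.site₁ c) :: r)) :
    G.mergeSign c s s' =
      listSign (G.position s) (.inl (D.site₁ c) :: .inl (D.site₂ c) :: r) *
        listSign (G.position s') (.inl (D.site₁ c) :: r) := by
  rw [mergeSign, G.restSign_eq E hm h, G.sign₂_eq (E.isTransversal_sites hm h), G.sign₁_eq h]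
  simp only [listSign, List.map_cons, List.prod_cons]
  ring

open Classical in
/-- The volume form of the order of the cycles of the state `s`, as an alternating function of a
list of points standing for the cycles through them. -/
noncomputable def form (s : State ι) (l : List D.Point) : ℤ :=
  if l.length = Fintype.card (D.Cycle s) then listSign (G.position s) l else 0

theorem form_eq_listSign (h : D.IsTransversal s l) : G.form s l = listSign (G.position s) l :=
  if_pos h.length_eq

theorem form_eq_zero (h : ¬ D.IsTransversal s l) : G.form s l = 0 := by
  rw [form]
  split_ifs with hl
  · exact listSign_eq_zero fun hn => h ⟨G.nodup_position_iff.1 hn, hl⟩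
  · rfl

theorem form_mul_self (h : D.IsTransversal s l) : G.form s l * G.form s l = 1 := by
  rw [G.form_eq_listSign h, listSign_mul_self (G.nodup_position_iff.2 h.nodup)]

theorem form_swap (s : State ι) (a b : D.Point) (l : List D.Point) :
    G.form s (a :: b :: l) = -G.form s (b :: a :: l) := by
  simp only [form, List.length_cons]
  split_ifs
  exacts [listSign_swap a b l, neg_zero.symm]

theorem form_append_cons (s : State ι) (a : D.Point) (l₁ l₂ : List D.Point) :
    G.form s (l₁ ++ a :: l₂) = (-1) ^ l₁.length * G.form s (a :: (l₁ ++ l₂)) := by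
  simp only [form, List.perm_middle.length_eq]
  split_ifs
  exacts [listSign_append_cons a l₁ l₂, (mul_zero _).symm]

theorem form_congr {a b : D.Point} (h : D.cycleThrough s a = D.cycleThrough s b)
    (l : List D.Point) : G.form s (a :: l) = G.form s (b :: l) := by
  simp only [form, List.length_cons, listSign_cons_congr (G.position_eq_iff.2 h)]

theorem form_eq_zero_of_eq {a b : D.Point} (h : D.cycleThrough s a = D.cycleThrough s b)
    (l : List D.Point) : G.form s (a :: b :: l) = 0 :=
  G.form_eq_zero fun ht => ht.ne_of_mem List.mem_cons_self h.symm

theorem exists_form_ne_zero (s : State ι) : ∃ l, G.form s l ≠ 0 := by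
  have ht : D.IsTransversal s ((Finset.univ : Finset (D.Cycle s)).toList.map (G.mark s)) := by
    refine ⟨?_, by simp⟩
    rw [List.map_map, show D.cycleThrough s ∘ G.mark s = id from funext (G.cycleThrough_mark s),
      List.map_id]
    exact Finset.nodup_toList _
  exact ⟨_, left_ne_zero_of_mul (by rw [G.form_mul_self ht]; exact one_ne_zero)⟩

theorem form_merge_cons (E : D.MonochromaticEdge χ c s s')
    (hm : D.cycleOf s (D.site₁ c) ≠ D.cycleOf s (D.site₂ c)) {a : D.Point}
    (ha : D.cycleThrough s' a = D.cycleThrough s' (.inl (D.site₁ c)))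
    (h : D.IsTransversal s' (.inl (D.site₁ c) :: r)) :
    G.form s' (a :: r) = G.mergeSign c s s' *
      (G.form s (.inl (D.site₁ c) :: a :: r) - G.form s (.inl (D.site₂ c) :: a :: r)) := by
  have ht := E.isTransversal_sites hm h
  have hsq := G.form_mul_self ht
  rw [G.form_congr ha, G.mergeSign_eq E hm h, ← G.form_eq_listSign h, ← G.form_eq_listSign ht]
  have hsite : D.cycleThrough s a = D.cycleThrough s (.inl (D.site₁ c)) ∨
      D.cycleThrough s a = D.cycleThrough s (.inl (D.site₂ c)) := by
    rcases (E.cycleThrough_eq_iff_of_merge hm).1 ha with h₁ | ⟨h₁, -⟩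
    · exact .inl h₁
    · exact not_and_or.1 h₁ |>.imp not_not.1 not_not.1
  rcases hsite with h₁ | h₂
  · rw [G.form_eq_zero_of_eq h₁.symm, G.form_swap s _ a, G.form_congr h₁]
    linear_combination (-G.form s' (.inl (D.site₁ c) :: r)) * hsq
  · rw [G.form_eq_zero_of_eq h₂.symm, G.form_swap s _ a, G.form_congr h₂,
      G.form_swap s (.inl (D.site₂ c))]
    linear_combination (-G.form s' (.inl (D.site₁ c) :: r)) * hsq

theorem form_merge (E : D.MonochromaticEdge χ c s s')
    (hm : D.cycleOf s (D.site₁ c) ≠ D.cycleOf s (D.site₂ c)) (l : List D.Point) :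
    G.form s' l = G.mergeSign c s s' *
      (G.form s (.inl (D.site₁ c) :: l) - G.form s (.inl (D.site₂ c) :: l)) := by
  by_cases h : D.IsTransversal s' l
  · obtain ⟨a, ha, hax⟩ := h.exists_mem (D.cycleThrough s' (.inl (D.site₁ c)))
    obtain ⟨l₁, l₂, rfl⟩ := List.append_of_mem ha
    have hmove (z : D.Point) : G.form s (z :: (l₁ ++ a :: l₂)) =
        (-1) ^ l₁.length * G.form s (z :: a :: (l₁ ++ l₂)) := by
      rw [G.form_swap s z, ← List.cons_append, G.form_append_cons, List.length_cons,
        List.cons_append, pow_succ]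
      ring
    rw [G.form_append_cons, hmove, hmove,
      G.form_merge_cons E hm hax ((h.perm List.perm_middle).cons_congr hax)]
    ring
  · have hzero {z : D.Point} (hz : ¬ D.Avoids c s z) : G.form s (z :: l) = 0 :=
      G.form_eq_zero fun ht => h (E.isTransversal_of_cons hm hz ht)
    rw [G.form_eq_zero h, hzero (by simp [Avoids]), hzero (by simp [Avoids]), sub_zero, mul_zero]

end GlobalData

end VirtualLinkDiagram

/-! ### Anticommutativity of the faces of the cube -/

namespace VirtualLinkDiagram

variable {D : VirtualLinkDiagram ι} [Finite ι] {χ : HalfEdge ι → Colour} {ψ : D.Point → Colour}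
  {c c' : ι} {s s' t t₁ t₂ u : State ι} {β β' : Bool}

theorem Paired.form_sub_form (hp : D.Paired s c c' β) (G : D.GlobalData) (l : List D.Point) :
    G.form s (.inl (D.site₁ c) :: l) - G.form s (.inl (D.site₂ c) :: l) =
      (-1) ^ β.toNat *
        (G.form s (.inl (D.site₁ c') :: l) - G.form s (.inl (D.site₂ c') :: l)) := by
  have h₁ : G.form s (.inl (D.site₁ c) :: l) = G.form s (.inl (D.site c' (true ^^ β)) :: l) :=
    G.form_congr (by simp only [cycleThrough_inl, ← hp true]; rfl) l
  have h₂ : G.form s (.inl (D.site₂ c) :: l) = G.form s (.inl (D.site c' (false ^^ β)) :: l) :=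
    G.form_congr (by simp only [cycleThrough_inl, ← hp false]; rfl) l
  rw [h₁, h₂]
  cases β
  · simp [site, site₁, site₂]
  · simp [site, site₁, site₂]

theorem Paired.splitWeight_eq (hp : D.Paired s c c' β) (hp' : D.Paired s' c c' β') (hcc : c ≠ c')
    (hm : D.cycleOf s (D.site₁ c) ≠ D.cycleOf s (D.site₂ c))
    (E' : D.MonochromaticEdge χ c' s t) (E : D.MonochromaticEdge χ c t s') :
    (χ (D.site₁ c')).splitWeight =
      -((-1) ^ β.toNat * (-1) ^ β'.toNat * (χ (D.site₁ c)).splitWeight) := by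
  have hβ := hp.eq_iff_of_resmooth hp' hcc hm E' E
  revert hβ
  cases β <;> cases β' <;> cases χ (D.site₁ c) <;> cases χ (D.site₁ c') <;>
    simp [Colour.splitWeight]

namespace GlobalData

variable (G : D.GlobalData)

theorem mergeSign_anticomm (E₁ : D.MonochromaticEdge χ c t t₁) (E₂ : D.MonochromaticEdge χ c' t t₂)
    (F₁ : D.MonochromaticEdge χ c' t₁ u) (F₂ : D.MonochromaticEdge χ c t₂ u)
    (hE₁ : D.cycleOf t (D.site₁ c) ≠ D.cycleOf t (D.site₂ c))
    (hE₂ : D.cycleOf t (D.site₁ c') ≠ D.cycleOf t (D.site₂ c'))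
    (hF₁ : D.cycleOf t₁ (D.site₁ c') ≠ D.cycleOf t₁ (D.site₂ c'))
    (hF₂ : D.cycleOf t₂ (D.site₁ c) ≠ D.cycleOf t₂ (D.site₂ c)) :
    G.mergeSign c t t₁ * G.mergeSign c' t₁ u + G.mergeSign c' t t₂ * G.mergeSign c t₂ u = 0 := by
  obtain ⟨l, hl⟩ := G.exists_form_ne_zero u
  have h₁ := G.form_merge F₁ hF₁ l
  have h₂ := G.form_merge F₂ hF₂ l
  simp only [G.form_merge E₁ hE₁] at h₁
  simp only [G.form_merge E₂ hE₂, G.form_swap t (.inl (D.site₁ c')),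
    G.form_swap t (.inl (D.site₂ c'))] at h₂
  refine (mul_eq_zero.1 ?_).resolve_right hl
  linear_combination (G.mergeSign c' t t₂ * G.mergeSign c t₂ u) * h₁ +
    (G.mergeSign c t t₁ * G.mergeSign c' t₁ u) * h₂

theorem splitWeight_eq_mergeSign (hcc : c ≠ c')
    (E₁ : D.MonochromaticEdge χ c t t₁) (E₂ : D.MonochromaticEdge χ c' t t₂)
    (F₁ : D.MonochromaticEdge χ c' u t₁) (F₂ : D.MonochromaticEdge χ c u t₂)
    (hE₁ : D.cycleOf t (D.site₁ c) ≠ D.cycleOf t (D.site₂ c))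
    (hE₂ : D.cycleOf t (D.site₁ c') ≠ D.cycleOf t (D.site₂ c'))
    (hF₁ : D.cycleOf u (D.site₁ c') ≠ D.cycleOf u (D.site₂ c'))
    (hF₂ : D.cycleOf u (D.site₁ c) ≠ D.cycleOf u (D.site₂ c)) :
    (χ (D.site₁ c')).splitWeight = -(G.mergeSign c t t₁ * G.mergeSign c' t t₂ *
      (G.mergeSign c u t₂ * G.mergeSign c' u t₁) * (χ (D.site₁ c)).splitWeight) := by
  obtain ⟨β, hβ⟩ := E₁.exists_paired hE₁ hE₂ (F₁.cycleOf_site_eq_iff.2 hF₁)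
  obtain ⟨β', hβ'⟩ := F₂.exists_paired hF₂ hF₁ (E₂.cycleOf_site_eq_iff.2 hE₂)
  obtain ⟨l, hl⟩ := G.exists_form_ne_zero t₁
  have h₁ := G.form_merge E₁ hE₁ l
  have h₂ := G.form_merge E₂ hE₂ l
  have h₃ := G.form_merge F₂ hF₂ l
  have h₄ := G.form_merge F₁ hF₁ l
  rw [hβ.form_sub_form] at h₁
  rw [hβ'.form_sub_form] at h₃
  have hsigns : (-1) ^ β.toNat * (-1) ^ β'.toNat = G.mergeSign c t t₁ * G.mergeSign c' t t₂ *
      (G.mergeSign c u t₂ * G.mergeSign c' u t₁) := by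
    -- Going once around the face multiplies the form of `t₁` by all six signs.
    refine mul_right_cancel₀ hl ?_
    grind [mergeSign_mul_self]
  rw [hβ.splitWeight_eq hβ' hcc hE₁ E₂ F₂.symm, hsigns]

end GlobalData

open GlobalData in
theorem MonochromaticEdge.merge_or_split (E : D.MonochromaticEdge (ψ ∘ .inl) c s s')
    (G : D.GlobalData) :
    D.cycleOf s (D.site₁ c) ≠ D.cycleOf s (D.site₂ c) ∧
        Fintype.card (D.Cycle s) = Fintype.card (D.Cycle s') + 1 ∧
        G.restSign c s s' * G.localWeight c s s' ψ = G.mergeSign c s s' ∨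
      D.cycleOf s' (D.site₁ c) ≠ D.cycleOf s' (D.site₂ c) ∧
        Fintype.card (D.Cycle s') = Fintype.card (D.Cycle s) + 1 ∧
        G.restSign c s s' * G.localWeight c s s' ψ =
          G.mergeSign c s' s * (ψ (.inl (D.site₁ c))).splitWeight := by
  by_cases hm : D.cycleOf s (D.site₁ c) = D.cycleOf s (D.site₂ c)
  · have hm' := E.symm.cycleOf_site_eq_iff.1 hm
    refine .inr ⟨hm', E.symm.card_cycle_of_merge hm', ?_⟩
    rw [localWeight, if_neg (fun h => h.1 hm), if_pos ⟨hm, hm'⟩, mergeSign, G.restSign_symm E]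
    ring
  · refine .inl ⟨hm, E.card_cycle_of_merge hm, ?_⟩
    rw [localWeight, if_pos ⟨hm, E.cycleOf_site_eq_iff.2 hm⟩, mergeSign]

theorem GlobalData.face_anticomm (G : D.GlobalData) {s₀₀ s₁₀ s₀₁ s₁₁ : State ι} (hcc : c ≠ c')
    (Ea : D.MonochromaticEdge (ψ ∘ .inl) c s₀₀ s₁₀) (Eb : D.MonochromaticEdge (ψ ∘ .inl) c s₀₁ s₁₁)
    (Ec : D.MonochromaticEdge (ψ ∘ .inl) c' s₀₀ s₀₁)
    (Ed : D.MonochromaticEdge (ψ ∘ .inl) c' s₁₀ s₁₁) :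
    (G.restSign c s₀₀ s₁₀ * G.localWeight c s₀₀ s₁₀ ψ) *
        (G.restSign c' s₁₀ s₁₁ * G.localWeight c' s₁₀ s₁₁ ψ) +
      (G.restSign c' s₀₀ s₀₁ * G.localWeight c' s₀₀ s₀₁ ψ) *
        (G.restSign c s₀₁ s₁₁ * G.localWeight c s₀₁ s₁₁ ψ) = 0 := by
  -- Counting cycles leaves six faces.  Four of them consist of the merges from one of the corners;
  -- in the other two, cycles merge along all edges at each of two opposite corners.
  rcases Ea.merge_or_split G with ⟨ha, na, wa⟩ | ⟨ha, na, wa⟩ <;>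
  rcases Eb.merge_or_split G with ⟨hb, nb, wb⟩ | ⟨hb, nb, wb⟩ <;>
  rcases Ec.merge_or_split G with ⟨hc, nc, wc⟩ | ⟨hc, nc, wc⟩ <;>
  rcases Ed.merge_or_split G with ⟨hd, nd, wd⟩ | ⟨hd, nd, wd⟩ <;>
  first
  | (exfalso; omega)
  | rw [wa, wb, wc, wd]
  · exact G.mergeSign_anticomm Ea Ec Ed Eb ha hc hd hb
  · have key := G.mergeSign_anticomm Eb Ec.symm Ed.symm Ea hb hc hd ha
    grind [mergeSign_mul_self]
  · have key := G.splitWeight_eq_mergeSign hcc Ea Ec Ed.symm Eb.symm ha hc hd hb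
    grind [mergeSign_mul_self]
  · have key := G.splitWeight_eq_mergeSign hcc Ea.symm Ed Ec.symm Eb ha hd hc hb
    grind [mergeSign_mul_self]
  · have key := G.mergeSign_anticomm Ea.symm Ed Ec Eb.symm ha hd hc hb
    grind [mergeSign_mul_self]
  · have key := G.mergeSign_anticomm Eb.symm Ed.symm Ec.symm Ea.symm hb hd hc ha
    grind [mergeSign_mul_self]

end VirtualLinkDiagram

/-! ### Cancellation along the edges of the cube -/

theorem sum_mul_sum_eq_zero_of_anticomm {A : Type*} [NonUnitalNonAssocSemiring A] {a : ι → A}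
    (hself : ∀ c, a c * a c = 0) (h : ∀ c c', c ≠ c' → a c * a c' + a c' * a c = 0)
    (s : Finset ι) : (∑ c ∈ s, a c) * ∑ c ∈ s, a c = 0 := by
  classical
  induction s using Finset.induction_on with
  | empty => simp
  | insert c s hc ih =>
    have hcross : a c * ∑ d ∈ s, a d + (∑ d ∈ s, a d) * a c = 0 := by
      rw [Finset.mul_sum, Finset.sum_mul, ← Finset.sum_add_distrib]
      exact Finset.sum_eq_zero fun d hd => h c d fun e => hc (e ▸ hd)
    rw [Finset.sum_insert hc, add_mul, mul_add, mul_add, hself, ih, zero_add, add_zero, hcross]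

section Tensors

variable (R : Type*) [CommRing R] {Z : Type*} [Fintype Z] [DecidableEq Z]

/-- The functional on `V^{⊗ Z}` dual to the tensor product of the idempotents given by `k`. -/
def colourFunctional (k : Z → Colour) : ((Z → Label) → R) →ₗ[R] R :=
  ∑ l : Z → Label, (∏ z, (k z).dualCoeff R (l z)) • LinearMap.proj l

theorem colourFunctional_apply (k : Z → Colour) (w : (Z → Label) → R) :
    colourFunctional R k w = ∑ l, (∏ z, (k z).dualCoeff R (l z)) * w l := by
  simp [colourFunctional]

variable [Invertible (2 : R)]

theorem colourFunctional_prod_coeff (h k : Z → Colour) :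
    colourFunctional R k (fun l => ∏ z, (h z).coeff R (l z)) = if h = k then 1 else 0 := by
  simp only [colourFunctional_apply, ← Finset.prod_mul_distrib,
    mul_comm (Colour.dualCoeff R _ _)]
  rw [← Fintype.piFinset_univ, ← Finset.prod_univ_sum (fun _ => Finset.univ)
    fun z a => (h z).coeff R a * (k z).dualCoeff R a]
  simp only [Colour.sum_coeff_mul_dualCoeff, Fintype.prod_ite_zero, Finset.prod_const_one,
    funext_iff]

theorem sum_prod_dualCoeff_mul_coeff (a b : Z → Label) :
    ∑ k : Z → Colour, (∏ z, (k z).dualCoeff R (b z)) * ∏ z, (k z).coeff R (a z) =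
      if a = b then 1 else 0 := by
  simp only [← Finset.prod_mul_distrib, mul_comm (Colour.dualCoeff R _ _)]
  rw [← Fintype.piFinset_univ, ← Finset.prod_univ_sum (fun _ => Finset.univ)
    fun z k => Colour.coeff R k (a z) * k.dualCoeff R (b z)]
  simp only [Colour.sum_dualCoeff_mul_coeff, Fintype.prod_ite_zero, Finset.prod_const_one,
    funext_iff]

theorem sum_colourFunctional_mul_prod_coeff (w : (Z → Label) → R) (l₀ : Z → Label) :
    ∑ k : Z → Colour, colourFunctional R k w * ∏ z, (k z).coeff R (l₀ z) = w l₀ := by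
  simp only [colourFunctional_apply, Finset.sum_mul, mul_right_comm _ (w _)]
  rw [Finset.sum_comm]
  simp [← Finset.sum_mul, sum_prod_dualCoeff_mul_coeff]

theorem toLin'_colourProjection {Z : Type} [Fintype Z] [DecidableEq Z] (k : Z → Colour) :
    (colourProjection R k).toLin' =
      (colourFunctional R k).smulRight fun l => ∏ z, (k z).coeff R (l z) := by
  refine LinearMap.ext fun w => funext fun l => ?_
  rw [Matrix.toLin'_apply, LinearMap.smulRight_apply, Pi.smul_apply, colourFunctional_apply,
    smul_eq_mul, Finset.sum_mul]
  refine Finset.sum_congr rfl fun l' _ => ?_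
  simp only [colourProjection, Colour.projCoeff_eq, Finset.prod_mul_distrib]
  ring

end Tensors

namespace VirtualLinkDiagram

/-- The colourings of the points that are compatible with the state `s`. -/
abbrev Colouring (D : VirtualLinkDiagram ι) (s : State ι) : Type :=
  {ψ : D.Point → Colour // D.Compatible s (ψ ∘ .inl)}

/-- The states together with a compatible colouring; they index the basis of colour vectors. -/
abbrev ColouredState (D : VirtualLinkDiagram ι) : Type := (s : State ι) × D.Colouring s

noncomputable instance [Finite ι] (D : VirtualLinkDiagram ι) (s : State ι) :
    Fintype (D.Colouring s) :=
  Fintype.ofFinite _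

/-- The colouring has different colours at the two arcs of each crossing. -/
def Alternating (D : VirtualLinkDiagram ι) (ψ : D.Point → Colour) : Prop :=
  ∀ c, ψ (.inl (D.site₁ c)) ≠ ψ (.inl (D.site₂ c))

theorem Compatible.monochromaticEdge_update [DecidableEq ι] {D : VirtualLinkDiagram ι}
    {s : State ι} {χ : HalfEdge ι → Colour} {c : ι} (hχ : D.Compatible s χ)
    (hc : χ (D.site₁ c) = χ (D.site₂ c)) {b : Bool} (hs : s c ≠ b) :
    D.MonochromaticEdge χ c s (Function.update s c b) :=
  ⟨hχ, hc, fun _ hd => Function.update_of_ne hd _ _, by rwa [Function.update_self]⟩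

theorem Compatible.update [DecidableEq ι] {D : VirtualLinkDiagram ι} {s : State ι}
    {χ : HalfEdge ι → Colour} {c : ι} (hχ : D.Compatible s χ)
    (hc : χ (D.site₁ c) = χ (D.site₂ c)) (b : Bool) :
    D.Compatible (Function.update s c b) χ := by
  by_cases hs : s c = b
  · rwa [← hs, Function.update_eq_self]
  · exact (hχ.monochromaticEdge_update hc hs).symm.compatible

namespace GlobalData

variable {D : VirtualLinkDiagram ι}

theorem colouring_ext [Finite ι] (G : D.GlobalData) {s : State ι} {ψ ψ' : D.Point → Colour}
    (h : D.Compatible s (ψ ∘ .inl)) (h' : D.Compatible s (ψ' ∘ .inl))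
    (e : ∀ z, ψ (G.mark s z) = ψ' (G.mark s z)) : ψ = ψ' := by
  funext p
  rcases p with p | i
  · exact h.apply_eq h' (G.cycleOf_star s (D.cycleOf s p)) (e (.inl (D.cycleOf s p)))
  · exact e (.inr i)

/-- A compatible colouring is given by the colours at the marked points. -/
noncomputable def colouringEquiv [Finite ι] (G : D.GlobalData) (s : State ι) :
    D.Colouring s ≃ (D.Cycle s → Colour) :=
  Equiv.ofBijective (fun ψ z => ψ.1 (G.mark s z)) <| by
    constructor
    · intro ψ ψ' h
      exact Subtype.ext (G.colouring_ext ψ.2 ψ'.2 (congrFun h))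
    · intro k
      obtain ⟨χ, hχ, hk⟩ := exists_compatible_of_star (G.cycleOf_star s) fun z => k (.inl z)
      refine ⟨⟨Sum.elim χ fun i => k (.inr i), hχ⟩, funext fun z => ?_⟩
      rcases z with z | i
      · exact hk z
      · rfl

section ColourBasis

variable [Fintype ι] (G : D.GlobalData) (R : Type*) [CommRing R]

/-- The coordinate functional of the colour vector of `(s, ψ)` in the basis of colour vectors. -/
noncomputable def colourCoord (s : State ι) (ψ : D.Point → Colour) :
    (D.EnhancedState → R) →ₗ[R] R :=
  colourFunctional R (fun z => ψ (G.mark s z)) ∘ₗ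
    LinearMap.funLeft R R (fun l => (⟨s, l⟩ : D.EnhancedState))

variable [Invertible (2 : R)]

open Classical in
theorem colourCoord_colourVector {s s' : State ι} {ψ ψ' : D.Point → Colour}
    (h : D.Compatible s (ψ ∘ .inl)) (h' : D.Compatible s' (ψ' ∘ .inl)) :
    G.colourCoord R s ψ (G.colourVector R s' ψ') = if s' = s ∧ ψ' = ψ then 1 else 0 := by
  have hvector : LinearMap.funLeft R R (fun l => (⟨s, l⟩ : D.EnhancedState))
      (G.colourVector R s' ψ') =
        fun l => if s' = s then ∏ z, (ψ' (G.mark s z)).coeff R (l z) else 0 :=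
    funext fun l => if_congr eq_comm rfl rfl
  rw [colourCoord, LinearMap.comp_apply, hvector]
  by_cases hs : s' = s
  · subst hs
    simp only [if_true, true_and, colourFunctional_prod_coeff]
    exact if_congr ⟨fun e => G.colouring_ext h' h (congrFun e), fun e => by rw [e]⟩ rfl rfl
  · simp only [hs, if_false, false_and]
    exact map_zero _

theorem sum_colourCoord_smul [DecidableEq ι] (v : D.EnhancedState → R) :
    ∑ t : D.ColouredState, G.colourCoord R t.1 t.2.1 v • G.colourVector R t.1 t.2.1 = v := by
  ext ⟨s, l₀⟩
  rw [Fintype.sum_sigma, Finset.sum_apply, Finset.sum_eq_single s]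
  · simp only [Finset.sum_apply, Pi.smul_apply, smul_eq_mul, colourVector, if_true]
    refine ((G.colouringEquiv s).sum_comp fun k : D.Cycle s → Colour =>
      colourFunctional R k (fun l => v ⟨s, l⟩) * ∏ z, (k z).coeff R (l₀ z)).trans ?_
    exact sum_colourFunctional_mul_prod_coeff R (fun l => v ⟨s, l⟩) l₀
  · intro s' _ hs'
    rw [Finset.sum_apply]
    refine Finset.sum_eq_zero fun ψ _ => ?_
    rw [Pi.smul_apply, colourVector, if_neg (Ne.symm hs'), smul_zero]
  · simp

variable {M : Type*} [AddCommMonoid M] [Module R M]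

variable {R} in
theorem ext_colourVector {f g : (D.EnhancedState → R) →ₗ[R] M}
    (h : ∀ s ψ, D.Compatible s (ψ ∘ .inl) →
      f (G.colourVector R s ψ) = g (G.colourVector R s ψ)) : f = g := by
  classical
  refine LinearMap.ext fun v => ?_
  rw [← G.sum_colourCoord_smul R v, map_sum, map_sum]
  refine Finset.sum_congr rfl fun t _ => ?_
  rw [map_smul, map_smul, h _ _ t.2.2]

variable [DecidableEq ι]

/-- The linear map with prescribed values on the basis of colour vectors; values at colourings that
are not compatible with the state are ignored. -/
noncomputable def colourConstr (f : State ι → (D.Point → Colour) → M) :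
    (D.EnhancedState → R) →ₗ[R] M :=
  ∑ t : D.ColouredState, (G.colourCoord R t.1 t.2.1).smulRight (f t.1 t.2.1)

theorem colourConstr_colourVector (f : State ι → (D.Point → Colour) → M) {s : State ι}
    {ψ : D.Point → Colour} (hχ : D.Compatible s (ψ ∘ .inl)) :
    G.colourConstr R f (G.colourVector R s ψ) = f s ψ := by
  classical
  rw [colourConstr, LinearMap.sum_apply, Finset.sum_eq_single ⟨s, ψ, hχ⟩]
  · rw [LinearMap.smulRight_apply, G.colourCoord_colourVector R hχ hχ, if_pos ⟨rfl, rfl⟩, one_smul]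
  · rintro ⟨s', ψ', h'⟩ - hne
    rw [LinearMap.smulRight_apply, G.colourCoord_colourVector R h' hχ, if_neg, zero_smul]
    rintro ⟨rfl, rfl⟩
    exact hne rfl
  · simp

end ColourBasis

section Edges

variable [Fintype ι] [DecidableEq ι] (G : D.GlobalData) {s : State ι} {ψ : D.Point → Colour}
  {c c' : ι}

theorem edgeWeight_anticomm (hχ : D.Compatible s (ψ ∘ .inl))
    (hc : ψ (.inl (D.site₁ c)) = ψ (.inl (D.site₂ c)))
    (hc' : ψ (.inl (D.site₁ c')) = ψ (.inl (D.site₂ c'))) (hcc : c ≠ c')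
    (hs : s c = false) (hs' : s c' = false) :
    G.edgeWeight c s ψ * G.edgeWeight c' (Function.update s c true) ψ +
      G.edgeWeight c' s ψ * G.edgeWeight c (Function.update s c' true) ψ = 0 := by
  have Ea := hχ.monochromaticEdge_update (b := true) hc (by simp [hs])
  have Ec := hχ.monochromaticEdge_update (b := true) hc' (by simp [hs'])
  have Eb := Ec.symm.compatible.monochromaticEdge_update (b := true) hc (by simp [hs, hcc])
  have Ed := Ea.symm.compatible.monochromaticEdge_update (b := true) hc' (by simp [hs', hcc.symm])
  rw [Function.update_comm hcc.symm] at Eb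
  rw [edgeWeight, edgeWeight, edgeWeight, edgeWeight, Function.update_comm hcc.symm]
  exact G.face_anticomm hcc Ea Eb Ec Ed

variable (R : Type*) [CommRing R] [Invertible (2 : R)]

theorem isUnit_edgeWeight (hχ : D.Compatible s (ψ ∘ .inl))
    (hc : ψ (.inl (D.site₁ c)) = ψ (.inl (D.site₂ c))) (hs : s c = false) :
    IsUnit (G.edgeWeight c s ψ : R) := by
  have hsign (t t' : State ι) : IsUnit (G.mergeSign c t t' : R) :=
    .of_mul_eq_one (G.mergeSign c t t' : R) <| by
      rw [← Int.cast_mul, G.mergeSign_mul_self, Int.cast_one]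
  have htwo : IsUnit (2 : R) := isUnit_of_invertible 2
  have E := hχ.monochromaticEdge_update (b := true) hc (by simp [hs])
  rw [edgeWeight]
  rcases E.merge_or_split G with ⟨-, -, h⟩ | ⟨-, -, h⟩
  · rw [h]
    exact hsign _ _
  · rw [h, Int.cast_mul]
    refine (hsign _ _).mul ?_
    cases ψ (.inl (D.site₁ c)) <;> simp [Colour.splitWeight, htwo]

/-- The part of the differential that resmooths the crossing `c`, described on colour vectors. -/
noncomputable def edgeMap (c : ι) : Module.End R (D.EnhancedState → R) :=
  G.colourConstr R fun s ψ =>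
    if s c = false ∧ ψ (.inl (D.site₁ c)) = ψ (.inl (D.site₂ c)) then
      (G.edgeWeight c s ψ : R) • G.colourVector R (Function.update s c true) ψ else 0

theorem edgeMap_of_mono (hχ : D.Compatible s (ψ ∘ .inl))
    (hc : ψ (.inl (D.site₁ c)) = ψ (.inl (D.site₂ c))) (hs : s c = false) :
    G.edgeMap R c (G.colourVector R s ψ) =
      (G.edgeWeight c s ψ : R) • G.colourVector R (Function.update s c true) ψ := by
  rw [edgeMap, colourConstr_colourVector _ _ _ hχ, if_pos ⟨hs, hc⟩]

theorem edgeMap_eq_zero (hχ : D.Compatible s (ψ ∘ .inl))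
    (h : ¬ (s c = false ∧ ψ (.inl (D.site₁ c)) = ψ (.inl (D.site₂ c)))) :
    G.edgeMap R c (G.colourVector R s ψ) = 0 := by
  rw [edgeMap, colourConstr_colourVector _ _ _ hχ, if_neg h]

theorem edgeMap_edgeMap_eq_zero (hχ : D.Compatible s (ψ ∘ .inl)) (hcc : c ≠ c')
    (h : ¬ (s c = false ∧ ψ (.inl (D.site₁ c)) = ψ (.inl (D.site₂ c)))) :
    G.edgeMap R c (G.edgeMap R c' (G.colourVector R s ψ)) = 0 := by
  by_cases h' : s c' = false ∧ ψ (.inl (D.site₁ c')) = ψ (.inl (D.site₂ c'))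
  · rw [G.edgeMap_of_mono R hχ h'.2 h'.1, map_smul, G.edgeMap_eq_zero R (hχ.update h'.2 true)
      (by rwa [Function.update_of_ne hcc]), smul_zero]
  · rw [G.edgeMap_eq_zero R hχ h', map_zero]

theorem toLin'_differential : (G.differential R).toLin' = ∑ c, G.edgeMap R c := by
  refine G.ext_colourVector fun s ψ hχ => ?_
  rw [Matrix.toLin'_apply, G.differential_mulVec_colourVector R hχ, LinearMap.sum_apply]
  exact Finset.sum_congr rfl fun c _ => by rw [edgeMap, G.colourConstr_colourVector R _ hχ]

theorem edgeMap_mul_self (c : ι) : G.edgeMap R c * G.edgeMap R c = 0 := by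
  refine G.ext_colourVector fun s ψ hχ => ?_
  rw [Module.End.mul_apply, LinearMap.zero_apply]
  by_cases h : s c = false ∧ ψ (.inl (D.site₁ c)) = ψ (.inl (D.site₂ c))
  · rw [G.edgeMap_of_mono R hχ h.2 h.1, map_smul,
      G.edgeMap_eq_zero R (hχ.update h.2 true) (by simp), smul_zero]
  · rw [G.edgeMap_eq_zero R hχ h, map_zero]

theorem edgeMap_mul_add_mul (hcc : c ≠ c') :
    G.edgeMap R c * G.edgeMap R c' + G.edgeMap R c' * G.edgeMap R c = 0 := by
  refine G.ext_colourVector fun s ψ hχ => ?_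
  rw [LinearMap.add_apply, Module.End.mul_apply, Module.End.mul_apply, LinearMap.zero_apply]
  by_cases h : s c = false ∧ ψ (.inl (D.site₁ c)) = ψ (.inl (D.site₂ c))
  swap
  · rw [G.edgeMap_edgeMap_eq_zero R hχ hcc h, G.edgeMap_eq_zero R hχ h, map_zero, add_zero]
  by_cases h' : s c' = false ∧ ψ (.inl (D.site₁ c')) = ψ (.inl (D.site₂ c'))
  swap
  · rw [G.edgeMap_edgeMap_eq_zero R hχ hcc.symm h', G.edgeMap_eq_zero R hχ h', map_zero, add_zero]
  obtain ⟨hs, hc⟩ := h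
  obtain ⟨hs', hc'⟩ := h'
  have hanti := congrArg (Int.cast : ℤ → R) (G.edgeWeight_anticomm hχ hc hc' hcc hs hs')
  push_cast at hanti
  rw [G.edgeMap_of_mono R hχ hc hs, G.edgeMap_of_mono R hχ hc' hs', map_smul, map_smul,
    G.edgeMap_of_mono R (hχ.update hc' true) hc (by rwa [Function.update_of_ne hcc]),
    G.edgeMap_of_mono R (hχ.update hc true) hc' (by rwa [Function.update_of_ne hcc.symm]),
    Function.update_comm hcc, smul_smul, smul_smul, ← add_smul, add_comm, hanti, zero_smul]

theorem differential_mul_self : G.differential R * G.differential R = 0 := by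
  refine Matrix.toLin'.injective ?_
  rw [Matrix.toLin'_mul, toLin'_differential, map_zero]
  exact sum_mul_sum_eq_zero_of_anticomm (G.edgeMap_mul_self R)
    (fun _ _ => G.edgeMap_mul_add_mul R) _

/-- The partial inverse of `edgeMap`: it changes a `B`-smoothing at `c` back to an `A`-smoothing and
divides by the weight of the edge. -/
noncomputable def edgeInverse (c : ι) : Module.End R (D.EnhancedState → R) :=
  G.colourConstr R fun s ψ =>
    if s c = true ∧ ψ (.inl (D.site₁ c)) = ψ (.inl (D.site₂ c)) then
      Ring.inverse (G.edgeWeight c (Function.update s c false) ψ : R) •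
        G.colourVector R (Function.update s c false) ψ else 0

theorem edgeInverse_of_mono (hχ : D.Compatible s (ψ ∘ .inl))
    (hc : ψ (.inl (D.site₁ c)) = ψ (.inl (D.site₂ c))) (hs : s c = true) :
    G.edgeInverse R c (G.colourVector R s ψ) =
      Ring.inverse (G.edgeWeight c (Function.update s c false) ψ : R) •
        G.colourVector R (Function.update s c false) ψ := by
  rw [edgeInverse, colourConstr_colourVector _ _ _ hχ, if_pos ⟨hs, hc⟩]

theorem edgeInverse_of_false (hχ : D.Compatible s (ψ ∘ .inl)) (hs : s c = false) :
    G.edgeInverse R c (G.colourVector R s ψ) = 0 := by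
  rw [edgeInverse, colourConstr_colourVector _ _ _ hχ, if_neg (by simp [hs])]

theorem edgeMap_edgeInverse_add_self (hχ : D.Compatible s (ψ ∘ .inl))
    (hc : ψ (.inl (D.site₁ c)) = ψ (.inl (D.site₂ c))) :
    G.edgeMap R c (G.edgeInverse R c (G.colourVector R s ψ)) +
      G.edgeInverse R c (G.edgeMap R c (G.colourVector R s ψ)) = G.colourVector R s ψ := by
  have hself (b : Bool) : Function.update s c b c = b := Function.update_self _ _ _
  cases hs : s c
  · have hback : Function.update (Function.update s c true) c false = s := by
      rw [Function.update_idem, ← hs, Function.update_eq_self]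
    rw [G.edgeInverse_of_false R hχ hs, map_zero, zero_add, G.edgeMap_of_mono R hχ hc hs, map_smul,
      G.edgeInverse_of_mono R (hχ.update hc true) hc (hself true), hback, smul_smul,
      Ring.mul_inverse_cancel _ (G.isUnit_edgeWeight R hχ hc hs), one_smul]
  · have hback : Function.update (Function.update s c false) c true = s := by
      rw [Function.update_idem, ← hs, Function.update_eq_self]
    rw [G.edgeMap_eq_zero R hχ (by simp [hs]), map_zero, add_zero,
      G.edgeInverse_of_mono R hχ hc hs, map_smul,
      G.edgeMap_of_mono R (hχ.update hc false) hc (hself false), hback, smul_smul,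
      Ring.inverse_mul_cancel _ (G.isUnit_edgeWeight R (hχ.update hc false) hc (hself false)),
      one_smul]

theorem edgeInverse_edgeMap_of_false (hχ : D.Compatible s (ψ ∘ .inl)) (hcc : c ≠ c')
    (hs : s c = false) : G.edgeInverse R c (G.edgeMap R c' (G.colourVector R s ψ)) = 0 := by
  by_cases h' : s c' = false ∧ ψ (.inl (D.site₁ c')) = ψ (.inl (D.site₂ c'))
  · rw [G.edgeMap_of_mono R hχ h'.2 h'.1, map_smul, G.edgeInverse_of_false R (hχ.update h'.2 true)
      (by rwa [Function.update_of_ne hcc]), smul_zero]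
  · rw [G.edgeMap_eq_zero R hχ h', map_zero]

theorem edgeInverse_edgeMap_edgeMap_of_false (hχ : D.Compatible s (ψ ∘ .inl)) (hcc : c ≠ c')
    (hc : ψ (.inl (D.site₁ c)) = ψ (.inl (D.site₂ c))) (hs : s c = false) :
    G.edgeInverse R c (G.edgeMap R c (G.edgeMap R c' (G.colourVector R s ψ))) =
      G.edgeMap R c' (G.colourVector R s ψ) := by
  by_cases h' : s c' = false ∧ ψ (.inl (D.site₁ c')) = ψ (.inl (D.site₂ c'))
  · have hχ' := hχ.update h'.2 true
    have hself := G.edgeMap_edgeInverse_add_self R hχ' hc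
    rw [G.edgeInverse_of_false R hχ' (by rwa [Function.update_of_ne hcc]), map_zero,
      zero_add] at hself
    rw [G.edgeMap_of_mono R hχ h'.2 h'.1, map_smul, map_smul, hself]
  · rw [G.edgeMap_eq_zero R hχ h', map_zero, map_zero]

theorem edgeMap_edgeInverse_add (hχ : D.Compatible s (ψ ∘ .inl)) (hcc : c ≠ c')
    (hc : ψ (.inl (D.site₁ c)) = ψ (.inl (D.site₂ c))) :
    G.edgeMap R c' (G.edgeInverse R c (G.colourVector R s ψ)) +
      G.edgeInverse R c (G.edgeMap R c' (G.colourVector R s ψ)) = 0 := by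
  cases hs : s c
  · rw [G.edgeInverse_of_false R hχ hs, G.edgeInverse_edgeMap_of_false R hχ hcc hs, map_zero,
      add_zero]
  -- It suffices to check this on `edgeMap c v`, which is a unit multiple of the given vector.
  set w := G.edgeInverse R c (G.colourVector R s ψ) with hw
  have hd : G.edgeMap R c w = G.colourVector R s ψ := by
    have hself := G.edgeMap_edgeInverse_add_self R hχ hc
    rwa [G.edgeMap_eq_zero R hχ (by simp [hs]), map_zero, add_zero] at hself
  have hχ₀ := hχ.update hc false
  have hs₀ : Function.update s c false c = false := Function.update_self _ _ _
  have hanti : G.edgeMap R c' (G.edgeMap R c w) = -G.edgeMap R c (G.edgeMap R c' w) :=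
    eq_neg_of_add_eq_zero_right (LinearMap.congr_fun (G.edgeMap_mul_add_mul R hcc) w)
  have hcancel : G.edgeInverse R c (G.edgeMap R c (G.edgeMap R c' w)) = G.edgeMap R c' w := by
    rw [hw, G.edgeInverse_of_mono R hχ hc hs, map_smul, map_smul, map_smul,
      G.edgeInverse_edgeMap_edgeMap_of_false R hχ₀ hcc hc hs₀]
  rw [← hd, hanti, map_neg, hcancel, add_neg_cancel]

open Classical in
/-- The contracting homotopy: on the cube of a colouring, the partial inverse at some crossing at
which the colouring has a single colour. -/
noncomputable def contraction : Module.End R (D.EnhancedState → R) :=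
  G.colourConstr R fun s ψ =>
    if h : ∃ c, ψ (.inl (D.site₁ c)) = ψ (.inl (D.site₂ c)) then
      G.edgeInverse R h.choose (G.colourVector R s ψ)
    else 0

open Classical in
theorem differential_contraction_add (hχ : D.Compatible s (ψ ∘ .inl)) :
    (G.differential R).toLin' (G.contraction R (G.colourVector R s ψ)) +
      G.contraction R ((G.differential R).toLin' (G.colourVector R s ψ)) =
      if D.Alternating ψ then 0 else G.colourVector R s ψ := by
  rw [toLin'_differential, LinearMap.sum_apply, LinearMap.sum_apply, map_sum]
  split_ifs with hψ
  · rw [Finset.sum_eq_zero, Finset.sum_eq_zero, add_zero]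
    · exact fun c _ => by rw [G.edgeMap_eq_zero R hχ fun h => hψ c h.2, map_zero]
    · intro c _
      rw [contraction, colourConstr_colourVector _ _ _ hχ, dif_neg (not_exists.2 hψ), map_zero]
  have h : ∃ c, ψ (.inl (D.site₁ c)) = ψ (.inl (D.site₂ c)) := by simpa [Alternating] using hψ
  obtain ⟨c₀, hc₀, hchoose⟩ : ∃ c₀, ψ (.inl (D.site₁ c₀)) = ψ (.inl (D.site₂ c₀)) ∧
      h.choose = c₀ := ⟨_, h.choose_spec, rfl⟩
  have hcontr {t : State ι} (ht : D.Compatible t (ψ ∘ .inl)) :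
      G.contraction R (G.colourVector R t ψ) = G.edgeInverse R c₀ (G.colourVector R t ψ) := by
    rw [contraction, colourConstr_colourVector _ _ _ ht, dif_pos h, hchoose]
  have hcontr' (c : ι) : G.contraction R (G.edgeMap R c (G.colourVector R s ψ)) =
      G.edgeInverse R c₀ (G.edgeMap R c (G.colourVector R s ψ)) := by
    by_cases hc : s c = false ∧ ψ (.inl (D.site₁ c)) = ψ (.inl (D.site₂ c))
    · rw [G.edgeMap_of_mono R hχ hc.2 hc.1, map_smul, map_smul, hcontr (hχ.update hc.2 true)]
    · rw [G.edgeMap_eq_zero R hχ hc, map_zero, map_zero]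
  simp only [hcontr hχ, hcontr']
  rw [← Finset.sum_add_distrib, Fintype.sum_eq_single c₀ fun c hc =>
    G.edgeMap_edgeInverse_add R hχ hc.symm hc₀, G.edgeMap_edgeInverse_add_self R hχ hc₀]

end Edges

end GlobalData

end VirtualLinkDiagram

/-! ### The homological degree -/

namespace VirtualLinkDiagram

variable [Fintype ι]

section Degrees

variable (D : VirtualLinkDiagram ι) (R : Type*) [CommRing R]

/-- The restriction of vectors to the enhanced states of degree `i`. -/
def restrict (i : ℤ) :
    (D.EnhancedState → R) →ₗ[R] ({x : D.EnhancedState // D.height x.1 = i} → R) :=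
  LinearMap.funLeft R R Subtype.val

/-- The extension by zero of vectors on the enhanced states of degree `i`. -/
noncomputable def extend (i : ℤ) :
    ({x : D.EnhancedState // D.height x.1 = i} → R) →ₗ[R] (D.EnhancedState → R) :=
  Function.ExtendByZero.linearMap R Subtype.val

theorem restrict_extend (i : ℤ) (v : {x : D.EnhancedState // D.height x.1 = i} → R) :
    D.restrict R i (D.extend R i v) = v :=
  funext fun _ => Subtype.val_injective.extend_apply _ _ _

theorem extend_restrict_apply (i : ℤ) (v : D.EnhancedState → R) (x : D.EnhancedState) :
    D.extend R i (D.restrict R i v) x = if D.height x.1 = i then v x else 0 := by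
  split_ifs with h
  · exact Subtype.val_injective.extend_apply (D.restrict R i v) 0 ⟨x, h⟩
  · exact Function.extend_apply' _ _ _ fun ⟨y, hy⟩ => h (hy ▸ y.2)

theorem restrict_extend_of_ne {i j : ℤ} (hij : i ≠ j)
    (v : {x : D.EnhancedState // D.height x.1 = i} → R) :
    D.restrict R j (D.extend R i v) = 0 := by
  rw [← D.restrict_extend R i v]
  refine funext fun x => (D.extend_restrict_apply R i _ x.1).trans (if_neg ?_)
  rw [x.2]
  exact hij.symm

variable {D R}

/-- The component of an endomorphism from degree `i` to degree `j`. -/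
noncomputable def component (f : Module.End R (D.EnhancedState → R)) (i j : ℤ) :
    ({x : D.EnhancedState // D.height x.1 = i} → R) →ₗ[R]
      ({x : D.EnhancedState // D.height x.1 = j} → R) :=
  D.restrict R j ∘ₗ f ∘ₗ D.extend R i

theorem component_apply (f : Module.End R (D.EnhancedState → R)) (i j : ℤ)
    (v : {x : D.EnhancedState // D.height x.1 = i} → R) :
    component f i j v = D.restrict R j (f (D.extend R i v)) :=
  rfl

theorem toLin'_submatrix [DecidableEq ι] (M : Matrix D.EnhancedState D.EnhancedState R) (i j : ℤ) :
    (M.submatrix (Subtype.val : {x : D.EnhancedState // D.height x.1 = j} → _)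
      (Subtype.val : {x : D.EnhancedState // D.height x.1 = i} → _)).toLin' =
      component M.toLin' i j := by
  refine LinearMap.ext fun v => funext fun y => ?_
  change ∑ x : {x : D.EnhancedState // D.height x.1 = i}, M y.1 x.1 * v x =
    ∑ x, M y.1 x * D.extend R i v x
  conv_rhs => rw [← D.restrict_extend R i v]
  simp only [extend_restrict_apply, mul_ite, mul_zero, ← Finset.sum_filter]
  rw [Finset.sum_subtype (p := fun x : D.EnhancedState => D.height x.1 = i) _ (by simp)]
  exact Finset.sum_congr rfl fun x _ => congrArg _ (congrFun (D.restrict_extend R i v) x).symm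

/-- A linear map that raises the degree by `k`. -/
def Homogeneous (k : ℤ) (f : Module.End R (D.EnhancedState → R)) : Prop :=
  ∀ i, D.extend R (i + k) ∘ₗ D.restrict R (i + k) ∘ₗ f = f ∘ₗ D.extend R i ∘ₗ D.restrict R i

variable {k i j l : ℤ} {f g : Module.End R (D.EnhancedState → R)}

theorem Homogeneous.extend_component (hf : Homogeneous k f) (hij : i + k = j)
    (v : {x : D.EnhancedState // D.height x.1 = i} → R) :
    D.extend R j (component f i j v) = f (D.extend R i v) := by
  subst hij
  have h := LinearMap.congr_fun (hf i) (D.extend R i v)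
  simp only [LinearMap.comp_apply, restrict_extend] at h
  exact h

theorem Homogeneous.component_comp (hf : Homogeneous k f) (hij : i + k = j) :
    component g j l ∘ₗ component f i j = component (g * f) i l :=
  LinearMap.ext fun v => congrArg (fun w => D.restrict R l (g w)) (hf.extend_component hij v)

theorem Homogeneous.component_eq_zero (hf : Homogeneous k f) (hij : i + k ≠ j) :
    component f i j = 0 := by
  refine LinearMap.ext fun v => ?_
  rw [component_apply, ← hf.extend_component rfl v, D.restrict_extend_of_ne R hij,
    LinearMap.zero_apply]

end Degrees

namespace GlobalData

variable {D : VirtualLinkDiagram ι} (G : D.GlobalData) (R : Type*) [CommRing R]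

variable {R} in
theorem complex_d [DecidableEq ι] (hd : G.differential R * G.differential R = 0) (i j : ℤ) :
    (G.complex R hd).d i j = ModuleCat.ofHom (component (G.differential R).toLin' i j) :=
  congrArg ModuleCat.ofHom (toLin'_submatrix (G.differential R) i j)

variable [Invertible (2 : R)]

theorem extend_restrict_colourVector (s : State ι) (ψ : D.Point → Colour) (i : ℤ) :
    D.extend R i (D.restrict R i (G.colourVector R s ψ)) =
      if D.height s = i then G.colourVector R s ψ else 0 := by
  funext x
  rw [extend_restrict_apply, colourVector]
  by_cases hx : x.1 = s
  · subst hx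
    by_cases h : D.height x.1 = i <;> simp [colourVector, h]
  · split_ifs <;> simp [colourVector, hx]

theorem restrict_colourVector_of_ne {s : State ι} {i : ℤ} (h : D.height s ≠ i)
    (ψ : D.Point → Colour) : D.restrict R i (G.colourVector R s ψ) = 0 := by
  rw [← D.restrict_extend R i (D.restrict R i _), extend_restrict_colourVector, if_neg h, map_zero]

theorem component_colourVector (f : Module.End R (D.EnhancedState → R)) {s : State ι} {i : ℤ}
    (hs : D.height s = i) (ψ : D.Point → Colour) (j : ℤ) :
    component f i j (D.restrict R i (G.colourVector R s ψ)) =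
      D.restrict R j (f (G.colourVector R s ψ)) := by
  rw [component_apply, extend_restrict_colourVector, if_pos hs]

variable {R}

theorem homogeneous_of_colourVector {k : ℤ} {f : Module.End R (D.EnhancedState → R)}
    (hf : ∀ s ψ, D.Compatible s (ψ ∘ .inl) →
      D.extend R (D.height s + k) (D.restrict R (D.height s + k) (f (G.colourVector R s ψ))) =
        f (G.colourVector R s ψ)) : Homogeneous k f := by
  refine fun i => G.ext_colourVector fun s ψ hχ => ?_
  simp only [LinearMap.comp_apply, extend_restrict_colourVector]
  split_ifs with h
  · rw [← h, hf s ψ hχ]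
  · rw [map_zero, ← hf s ψ hχ, D.restrict_extend_of_ne R fun e => h (add_right_cancel e), map_zero]

theorem ext_restrict {M : Type*} [AddCommMonoid M] [Module R M] {i : ℤ}
    {f g : ({x : D.EnhancedState // D.height x.1 = i} → R) →ₗ[R] M}
    (h : ∀ s ψ, D.Compatible s (ψ ∘ .inl) → D.height s = i →
      f (D.restrict R i (G.colourVector R s ψ)) = g (D.restrict R i (G.colourVector R s ψ))) :
    f = g := by
  have hcomp : f ∘ₗ D.restrict R i = g ∘ₗ D.restrict R i := by
    refine G.ext_colourVector fun s ψ hχ => ?_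
    by_cases hs : D.height s = i
    · exact h s ψ hχ hs
    · simp only [LinearMap.comp_apply, G.restrict_colourVector_of_ne R hs, map_zero]
  refine LinearMap.ext fun v => ?_
  rw [← D.restrict_extend R i v]
  exact LinearMap.congr_fun hcomp _

variable (R) [DecidableEq ι]

theorem homogeneous_differential : Homogeneous 1 (G.differential R).toLin' := by
  refine G.homogeneous_of_colourVector fun s ψ hχ => ?_
  rw [Matrix.toLin'_apply, G.differential_mulVec_colourVector R hχ, map_sum, map_sum]
  refine Finset.sum_congr rfl fun c _ => ?_
  split_ifs with h
  · rw [map_smul, map_smul, extend_restrict_colourVector, if_pos (D.height_update s c h.1)]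
  · rw [map_zero, map_zero]

theorem homogeneous_contraction : Homogeneous (-1) (G.contraction R) := by
  refine G.homogeneous_of_colourVector fun s ψ hχ => ?_
  rw [contraction, colourConstr_colourVector _ _ _ hχ]
  split_ifs with h
  · cases hs : s h.choose
    · rw [G.edgeInverse_of_false R hχ hs, map_zero, map_zero]
    · have hheight := D.height_update (Function.update s h.choose false) h.choose
        (Function.update_self _ _ _)
      rw [Function.update_idem, ← hs, Function.update_eq_self] at hheight
      rw [G.edgeInverse_of_mono R hχ h.choose_spec hs, map_smul, map_smul,
        extend_restrict_colourVector, if_pos (by rw [hheight, add_neg_cancel_right])]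
  · rw [map_zero, map_zero]

end GlobalData

end VirtualLinkDiagram

/-! ### Generators and summands in the Karoubi envelope -/

universe u

/-- The image of an idempotent of rank one in the Karoubi envelope is isomorphic to the base
ring. -/
noncomputable def karoubiIsoOfRankOne {R : Type u} [CommRing R]
    (P : Idempotents.Karoubi (ModuleCat.{u} R)) (φ : P.X →ₗ[R] R) (v : P.X) (h : φ v = 1)
    (hp : P.p = ModuleCat.ofHom (φ.smulRight v)) :
    P ≅ (Idempotents.toKaroubi (ModuleCat R)).obj (ModuleCat.of R R) where
  hom :=
    { f := ModuleCat.ofHom φ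
      comm := by
        ext w
        simp [hp, h] }
  inv :=
    { f := ModuleCat.ofHom (LinearMap.toSpanSingleton R P.X v)
      comm := by
        ext
        simp [hp, h] }
  hom_inv_id := by
    ext w
    simp [hp]
  inv_hom_id := by
    ext
    simp [h]

namespace AlternatelyColouredSmoothing

variable {D : VirtualLinkDiagram ι}

/-- The colours of the points, on the strands at crossings as well as on the components without
crossings. -/
def pointColour (a : AlternatelyColouredSmoothing D) : D.Point → Colour :=
  Sum.elim a.colour a.circleColour

theorem compatible (a : AlternatelyColouredSmoothing D) :
    D.Compatible a.state (a.pointColour ∘ .inl) :=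
  ⟨a.colour_smooth, a.colour_glue⟩

theorem alternating (a : AlternatelyColouredSmoothing D) : D.Alternating a.pointColour :=
  a.alternate

theorem ext_pointColour {a b : AlternatelyColouredSmoothing D} (hs : a.state = b.state)
    (h : a.pointColour = b.pointColour) : a = b :=
  AlternatelyColouredSmoothing.ext hs (funext fun x => congrFun h (.inl x))
    (funext fun i => congrFun h (.inr i))

/-- The alternately coloured smoothing given by a compatible alternating colouring. -/
def ofColouring {s : State ι} {ψ : D.Point → Colour} (h : D.Compatible s (ψ ∘ .inl))
    (hψ : D.Alternating ψ) : AlternatelyColouredSmoothing D where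
  state := s
  colour := ψ ∘ .inl
  circleColour := ψ ∘ .inr
  colour_smooth := h.smooth
  colour_glue := h.glue
  alternate := hψ

theorem pointColour_ofColouring {s : State ι} {ψ : D.Point → Colour}
    (h : D.Compatible s (ψ ∘ .inl)) (hψ : D.Alternating ψ) :
    (ofColouring h hψ).pointColour = ψ :=
  Sum.elim_comp_inl_inr ψ

noncomputable instance [Finite ι] : Fintype (AlternatelyColouredSmoothing D) :=
  Fintype.ofFinite _

variable [Fintype ι] (R : Type u) [CommRing R] [Invertible (2 : R)] (G : D.GlobalData)

/-- The generator of an alternately coloured smoothing is isomorphic to the base ring. -/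
noncomputable def generatorIso (a : AlternatelyColouredSmoothing D) :
    a.generator R G ≅ (Idempotents.toKaroubi (ModuleCat R)).obj (ModuleCat.of R R) :=
  karoubiIsoOfRankOne (a.generator R G) (colourFunctional R (a.cycleColour G))
    (fun l => ∏ z, (a.cycleColour G z).coeff R (l z))
    ((colourFunctional_prod_coeff R _ _).trans (if_pos rfl))
    (congrArg ModuleCat.ofHom (toLin'_colourProjection R _))

end AlternatelyColouredSmoothing

section Summands

open Limits

variable {K : Type*} [Category K] {C : Type*} [Category C] (F : C ⥤ K)

theorem map_comp_conj {X Y Z : C} {S T : K} (s : S ⟶ F.obj X) (f : X ⟶ Y) (g : Y ⟶ Z)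
    (t : F.obj Z ⟶ T) : (s ≫ F.map f) ≫ F.map g ≫ t = s ≫ F.map (f ≫ g) ≫ t := by
  rw [Category.assoc, F.map_comp_assoc]

theorem map_comp_iso_inv_hom {X Y Z : C} {S : K} (f : X ⟶ Y) (e : S ≅ F.obj Y) (g : Y ⟶ Z) :
    (F.map f ≫ e.inv) ≫ e.hom ≫ F.map g = F.map (f ≫ g) := by
  rw [Category.assoc, Iso.inv_hom_id_assoc, F.map_comp]

theorem map_comp_eq_zero_right [HasZeroMorphisms K] [HasZeroMorphisms C]
    [F.PreservesZeroMorphisms] {X Y Z : C} {T : K} (t : T ⟶ F.obj X) {f : X ⟶ Y} {g : Y ⟶ Z}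
    (h : f ≫ g = 0) : (t ≫ F.map f) ≫ F.map g = 0 := by
  rw [Category.assoc, ← F.map_comp, h, F.map_zero, comp_zero]

theorem map_comp_eq_zero_left [HasZeroMorphisms K] [HasZeroMorphisms C]
    [F.PreservesZeroMorphisms] {X Y Z : C} {T : K} (t : F.obj Z ⟶ T) {f : X ⟶ Y} {g : Y ⟶ Z}
    (h : f ≫ g = 0) : F.map f ≫ F.map g ≫ t = 0 := by
  rw [← Category.assoc, ← F.map_comp, h, F.map_zero, zero_comp]

variable {κ : Type*} (c : ComplexShape κ)

/-- The complex with vanishing differentials on the given objects. -/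
abbrev zeroDifferential [HasZeroMorphisms K] (X : κ → K) : HomologicalComplex K c where
  X := X
  d _ _ := 0

variable [Preadditive K] [HasFiniteBiproducts K]

variable {c} in
/-- A complex whose identity is homotopic to the projection to a family of direct summands on which
the differentials vanish is homotopy equivalent to the sum of these. -/
noncomputable def homotopyEquivOfSummands {A : HomologicalComplex K c} {J : κ → Type}
    [∀ i, Fintype (J i)] {Y : ∀ i, J i → K} (ε : ∀ i a, Y i a ⟶ A.X i)
    (π : ∀ i a, A.X i ⟶ Y i a) (hε : ∀ i j a, ε i a ≫ A.d i j = 0)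
    (hπ : ∀ i j, c.Rel i j → ∀ a, A.d i j ≫ π j a = 0) (h_one : ∀ i a, ε i a ≫ π i a = 𝟙 _)
    (h_zero : ∀ i a b, a ≠ b → ε i a ≫ π i b = 0) (P : A ⟶ A)
    (hP : ∀ i, P.f i = ∑ a, π i a ≫ ε i a) (H : Homotopy (𝟙 A) P) :
    HomotopyEquiv A (zeroDifferential c fun i => ⨁ Y i) where
  hom :=
    { f := fun i => biproduct.lift (π i)
      comm' := fun i j hij => by
        rw [comp_zero]
        exact (biproduct.hom_ext _ _ fun a => by simp [hπ i j hij a]).symm }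
  inv :=
    { f := fun i => biproduct.desc (ε i)
      comm' := fun i j _ => by
        rw [zero_comp]
        exact biproduct.hom_ext' _ _ fun a => by simp [hε i j a] }
  homotopyHomInvId := (H.trans (Homotopy.ofEq (by
    ext i
    rw [hP, HomologicalComplex.comp_f, biproduct.lift_desc]))).symm
  homotopyInvHomId := Homotopy.ofEq (by
    classical
    ext i : 1
    refine biproduct.hom_ext' _ _ fun a => biproduct.hom_ext _ _ fun b => ?_
    rw [HomologicalComplex.comp_f, HomologicalComplex.id_f, Category.comp_id,
      biproduct.ι_desc_assoc, Category.assoc, biproduct.lift_π]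
    rcases eq_or_ne a b with rfl | hab
    · rw [h_one, biproduct.ι_π_self]
    · rw [h_zero i a b hab, biproduct.ι_π_ne _ hab])

end Summands

namespace VirtualLinkDiagram.GlobalData

section Coordinates

variable [Fintype ι] {D : VirtualLinkDiagram ι} (G : D.GlobalData) (R : Type*) [CommRing R]
  [Invertible (2 : R)]

/-- The colour vector of an alternately coloured smoothing in degree `i`; it is zero unless `i` is
the degree of its state. -/
noncomputable def smoothingVector (i : ℤ) (a : AlternatelyColouredSmoothing D) :
    {x : D.EnhancedState // D.height x.1 = i} → R :=
  D.restrict R i (G.colourVector R a.state a.pointColour)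

/-- The coordinate functional of `smoothingVector` in the basis of colour vectors. -/
noncomputable def smoothingCoord (i : ℤ) (a : AlternatelyColouredSmoothing D) :
    ({x : D.EnhancedState // D.height x.1 = i} → R) →ₗ[R] R :=
  G.colourCoord R a.state a.pointColour ∘ₗ D.extend R i

open Classical in
theorem smoothingCoord_restrict {i : ℤ} (a : AlternatelyColouredSmoothing D) {s : State ι}
    {ψ : D.Point → Colour} (hχ : D.Compatible s (ψ ∘ .inl)) (hs : D.height s = i) :
    G.smoothingCoord R i a (D.restrict R i (G.colourVector R s ψ)) =
      if s = a.state ∧ ψ = a.pointColour then 1 else 0 := by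
  rw [smoothingCoord, LinearMap.comp_apply, extend_restrict_colourVector, if_pos hs,
    G.colourCoord_colourVector R a.compatible hχ]

open Classical in
theorem smoothingCoord_smoothingVector {i : ℤ} (a b : AlternatelyColouredSmoothing D)
    (hb : D.height b.state = i) :
    G.smoothingCoord R i a (G.smoothingVector R i b) = if b = a then 1 else 0 := by
  rw [smoothingVector, G.smoothingCoord_restrict R a b.compatible hb]
  refine if_congr ⟨fun h => AlternatelyColouredSmoothing.ext_pointColour h.1 h.2, ?_⟩ rfl rfl
  rintro rfl
  exact ⟨rfl, rfl⟩

/-- The projection of degree `i` to the span of the alternately coloured smoothings. -/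
noncomputable def alternatingProj (i : ℤ) :
    Module.End R ({x : D.EnhancedState // D.height x.1 = i} → R) :=
  ∑ a : {a : AlternatelyColouredSmoothing D // D.height a.state = i},
    (G.smoothingCoord R i a.1).smulRight (G.smoothingVector R i a.1)

open Classical in
theorem alternatingProj_restrict {i : ℤ} {s : State ι} {ψ : D.Point → Colour}
    (hχ : D.Compatible s (ψ ∘ .inl)) (hs : D.height s = i) :
    G.alternatingProj R i (D.restrict R i (G.colourVector R s ψ)) =
      if D.Alternating ψ then D.restrict R i (G.colourVector R s ψ) else 0 := by
  simp only [alternatingProj, LinearMap.sum_apply, LinearMap.smulRight_apply,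
    G.smoothingCoord_restrict R _ hχ hs]
  split_ifs with h
  · have ha := AlternatelyColouredSmoothing.pointColour_ofColouring hχ h
    rw [Fintype.sum_eq_single ⟨.ofColouring hχ h, hs⟩, if_pos ⟨rfl, ha.symm⟩, one_smul,
      smoothingVector, ha]
    · rfl
    · intro b hb
      refine (congrArg (· • _) (if_neg fun e => hb (Subtype.ext ?_))).trans (zero_smul R _)
      exact AlternatelyColouredSmoothing.ext_pointColour e.1.symm (e.2.symm.trans ha.symm)
  · refine Finset.sum_eq_zero fun a _ => ?_
    have hne : ¬ (s = a.1.state ∧ ψ = a.1.pointColour) := fun e => h (e.2 ▸ a.1.alternating)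
    rw [if_neg hne, zero_smul]

variable [DecidableEq ι]

theorem differential_smoothing (a : AlternatelyColouredSmoothing D) :
    (G.differential R).toLin' (G.colourVector R a.state a.pointColour) = 0 := by
  rw [toLin'_differential, LinearMap.sum_apply]
  exact Finset.sum_eq_zero fun c _ =>
    G.edgeMap_eq_zero R a.compatible fun h => a.alternating c h.2

theorem colourCoord_differential (a : AlternatelyColouredSmoothing D) :
    G.colourCoord R a.state a.pointColour ∘ₗ (G.differential R).toLin' = 0 := by
  refine G.ext_colourVector fun s ψ hχ => ?_
  rw [LinearMap.comp_apply, toLin'_differential, LinearMap.sum_apply, map_sum,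
    LinearMap.zero_apply]
  refine Finset.sum_eq_zero fun c _ => ?_
  by_cases h : s c = false ∧ ψ (.inl (D.site₁ c)) = ψ (.inl (D.site₂ c))
  · rw [G.edgeMap_of_mono R hχ h.2 h.1, map_smul,
      G.colourCoord_colourVector R a.compatible (hχ.update h.2 true), if_neg, smul_zero]
    rintro ⟨-, rfl⟩
    exact a.alternating c h.2
  · rw [G.edgeMap_eq_zero R hχ h, map_zero]

theorem component_differential_smoothingVector {i : ℤ} (j : ℤ)
    {a : AlternatelyColouredSmoothing D} (ha : D.height a.state = i) :
    component (G.differential R).toLin' i j (G.smoothingVector R i a) = 0 := by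
  rw [smoothingVector, G.component_colourVector R _ ha, differential_smoothing, map_zero]

theorem smoothingCoord_comp_component_differential {i j : ℤ} (hij : i + 1 = j)
    (a : AlternatelyColouredSmoothing D) :
    G.smoothingCoord R j a ∘ₗ component (G.differential R).toLin' i j = 0 := by
  refine LinearMap.ext fun v => ?_
  rw [smoothingCoord, LinearMap.comp_apply, LinearMap.comp_apply,
    (G.homogeneous_differential R).extend_component hij]
  exact LinearMap.congr_fun (G.colourCoord_differential R a) _

theorem component_differential_contraction_add (i : ℤ) :
    component (G.contraction R) (i + 1) i ∘ₗ component (G.differential R).toLin' i (i + 1) +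
      component (G.differential R).toLin' (i - 1) i ∘ₗ component (G.contraction R) i (i - 1) +
      G.alternatingProj R i = LinearMap.id := by
  classical
  rw [(G.homogeneous_differential R).component_comp rfl,
    (G.homogeneous_contraction R).component_comp (sub_eq_add_neg i 1).symm]
  refine G.ext_restrict fun s ψ hχ hs => ?_
  rw [LinearMap.add_apply, LinearMap.add_apply, G.component_colourVector R _ hs,
    G.component_colourVector R _ hs, ← map_add, Module.End.mul_apply, Module.End.mul_apply,
    add_comm (G.contraction R _), G.differential_contraction_add R hχ,
    G.alternatingProj_restrict R hχ hs, LinearMap.id_apply]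
  split_ifs
  · rw [map_zero, zero_add]
  · rw [add_zero]

end Coordinates

variable [Fintype ι] [DecidableEq ι] {D : VirtualLinkDiagram ι} (G : D.GlobalData)
  {R : Type u} [CommRing R] [Invertible (2 : R)]
  (hd : G.differential R * G.differential R = 0)

/-- The inclusion of the summand of an alternately coloured smoothing. -/
noncomputable def smoothingInclusion (i : ℤ) (a : AlternatelyColouredSmoothing D) :
    ModuleCat.of R R ⟶ (G.complex R hd).X i :=
  ModuleCat.ofHom (LinearMap.toSpanSingleton R _ (G.smoothingVector R i a))

/-- The projection to the summand of an alternately coloured smoothing. -/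
noncomputable def smoothingProjection (i : ℤ) (a : AlternatelyColouredSmoothing D) :
    (G.complex R hd).X i ⟶ ModuleCat.of R R :=
  ModuleCat.ofHom (G.smoothingCoord R i a)

theorem smoothingInclusion_d {i : ℤ} (j : ℤ) {a : AlternatelyColouredSmoothing D}
    (ha : D.height a.state = i) : G.smoothingInclusion hd i a ≫ (G.complex R hd).d i j = 0 := by
  rw [complex_d]
  refine congrArg ModuleCat.ofHom (?_ : component _ i j ∘ₗ LinearMap.toSpanSingleton R _ _ = 0)
  refine LinearMap.ext_ring ?_
  rw [LinearMap.comp_apply, LinearMap.toSpanSingleton_apply_one,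
    G.component_differential_smoothingVector R j ha, LinearMap.zero_apply]

theorem d_smoothingProjection {i j : ℤ} (hij : i + 1 = j) (a : AlternatelyColouredSmoothing D) :
    (G.complex R hd).d i j ≫ G.smoothingProjection hd j a = 0 := by
  rw [complex_d]
  exact congrArg ModuleCat.ofHom (G.smoothingCoord_comp_component_differential R hij a)

open Classical in
theorem smoothingInclusion_projection {i : ℤ} {a : AlternatelyColouredSmoothing D}
    (ha : D.height a.state = i) (b : AlternatelyColouredSmoothing D) :
    G.smoothingInclusion hd i a ≫ G.smoothingProjection hd i b =
      if a = b then 𝟙 (ModuleCat.of R R) else 0 := by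
  have happly : G.smoothingCoord R i b ∘ₗ LinearMap.toSpanSingleton R _ (G.smoothingVector R i a) =
      if a = b then LinearMap.id else 0 := by
    refine LinearMap.ext_ring ?_
    rw [LinearMap.comp_apply, LinearMap.toSpanSingleton_apply_one,
      G.smoothingCoord_smoothingVector R b a ha]
    split_ifs <;> rfl
  refine (congrArg ModuleCat.ofHom happly).trans ?_
  split_ifs <;> rfl

/-- The projection of the Khovanov-Lee complex to the span of the alternately coloured
smoothings. -/
noncomputable def alternatingProjection : G.complex R hd ⟶ G.complex R hd where
  f i := ∑ a : {a : AlternatelyColouredSmoothing D // D.height a.state = i},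
    G.smoothingProjection hd i a.1 ≫ G.smoothingInclusion hd i a.1
  comm' i j hij := by
    rw [Preadditive.sum_comp, Preadditive.comp_sum, Finset.sum_eq_zero, Finset.sum_eq_zero]
    · intro a _
      rw [← Category.assoc, G.d_smoothingProjection hd hij, Limits.zero_comp]
    · intro a _
      rw [Category.assoc, G.smoothingInclusion_d hd j a.2, Limits.comp_zero]

theorem alternatingProjection_f (i : ℤ) :
    (G.alternatingProjection hd).f i = ModuleCat.ofHom (G.alternatingProj R i) :=
  ModuleCat.hom_ext (ModuleCat.hom_sum _ _)

/-- The contraction as a family of morphisms between the terms of the complex. -/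
noncomputable def contractionHom (i j : ℤ) : (G.complex R hd).X i ⟶ (G.complex R hd).X j :=
  ModuleCat.ofHom (component (G.contraction R) i j)

/-- The contraction is a homotopy from the identity to the projection to the span of the alternately
coloured smoothings. -/
noncomputable def homotopyIdAlternatingProjection :
    Homotopy (𝟙 (G.complex R hd)) (G.alternatingProjection hd) where
  hom := G.contractionHom hd
  zero i j hij := by
    have hne : i + -1 ≠ j := fun h => hij (show j + 1 = i by omega)
    exact congrArg ModuleCat.ofHom ((G.homogeneous_contraction R).component_eq_zero hne)
  comm i := by
    rw [dNext_eq _ (show (ComplexShape.up ℤ).Rel i (i + 1) from rfl),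
      prevD_eq _ (show (ComplexShape.up ℤ).Rel (i - 1) i from sub_add_cancel i 1),
      complex_d, complex_d, alternatingProjection_f]
    exact congrArg ModuleCat.ofHom (G.component_differential_contraction_add R i).symm

/-- The Khovanov-Lee complex is homotopy equivalent to the complex of the generators. -/
noncomputable def homotopyEquivGeneratorComplex :
    HomotopyEquiv (((Idempotents.toKaroubi (ModuleCat R)).mapHomologicalComplex
      (ComplexShape.up ℤ)).obj (G.complex R hd)) (generatorComplex R G) :=
  let F := Idempotents.toKaroubi (ModuleCat.{u} R)
  homotopyEquivOfSummands
    (A := (F.mapHomologicalComplex (ComplexShape.up ℤ)).obj (G.complex R hd))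
    (Y := fun i (a : {a : AlternatelyColouredSmoothing D // D.height a.state = i}) =>
      a.1.generator R G)
    (fun i a => (a.1.generatorIso R G).hom ≫ F.map (G.smoothingInclusion hd i a.1))
    (fun i a => F.map (G.smoothingProjection hd i a.1) ≫ (a.1.generatorIso R G).inv)
    (fun _ j a => map_comp_eq_zero_right F _ (G.smoothingInclusion_d hd j a.2))
    (fun _ _ hij a => map_comp_eq_zero_left F _ (G.d_smoothingProjection hd hij a.1))
    (fun _ a => (map_comp_conj F _ _ _ _).trans <| by
      rw [G.smoothingInclusion_projection hd a.2, if_pos rfl, F.map_id, Category.id_comp,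
        Iso.hom_inv_id])
    (fun _ a b hab => (map_comp_conj F _ _ _ _).trans <| by
      rw [G.smoothingInclusion_projection hd a.2, if_neg fun h => hab (Subtype.ext h),
        F.map_zero, Limits.zero_comp, Limits.comp_zero])
    ((F.mapHomologicalComplex _).map (G.alternatingProjection hd))
    (fun _ => (F.map_sum _ _).trans <| Finset.sum_congr rfl fun a _ =>
      (map_comp_iso_inv_hom F _ (a.1.generatorIso R G) _).symm)
    ((Homotopy.ofEq ((F.mapHomologicalComplex _).map_id _).symm).trans
      (F.mapHomotopy (G.homotopyIdAlternatingProjection hd)))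

end VirtualLinkDiagram.GlobalData

end VirtualKhovanovLee

theorem mainTheorem5 {ι : Type} [Fintype ι] [DecidableEq ι]
    (D : VirtualKhovanovLee.VirtualLinkDiagram ι) (G : D.GlobalData)
    (R : Type*) [CommRing R] [Invertible (2 : R)] :
    ∃ hd : G.differential R * G.differential R = 0,
      Nonempty (HomotopyEquiv
        (((CategoryTheory.Idempotents.toKaroubi (ModuleCat R)).mapHomologicalComplex
          (ComplexShape.up ℤ)).obj (G.complex R hd))
        (VirtualKhovanovLee.generatorComplex R G)) ∧
      ∀ a : VirtualKhovanovLee.AlternatelyColouredSmoothing D,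
        Nonempty (a.generator R G ≅
          (CategoryTheory.Idempotents.toKaroubi (ModuleCat R)).obj (ModuleCat.of R R)) :=
  ⟨G.differential_mul_self R, ⟨G.homotopyEquivGeneratorComplex _⟩, fun a => ⟨a.generatorIso R G⟩⟩
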